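/- **Setting.** Let $(\Omega,\mathcal F,\mathbb P)$ be a probability space, $\Xi$ a Hilbert space with its Borel $\sigma$-field, $P$ a probability measure on $\Xi$, $\boldsymbol\xi$ a random element with law $P$, and $\boldsymbol\xi_1,\boldsymbol\xi_2,\dots:\Omega\to\Xi$ an iid sample from $P$. Let $\hat Z$ and $U$ be separable Banach spaces, $\hat A\subset\hat Z$, $\hat f:\hat Z\to\mathbb R$, $\hat g_1,\hat g_2:U\times\hat Z\to\mathbb R$, $s:\Xi\times\hat Z\to U$ (solution mapping), $s^\nu:\Xi\times\hat Z\to U$ (approximate solution mappings, $\nu\in\mathbb N=\{1,2,\dots\}$) and $\alpha\in(0,1)$. Measurability in $\xi$ is with respect to the completion of $P$. Put $Z=\hat Z\times\mathbb R^2$ with elements $z=(\hat z,\gamma,\sigma)$, $A=\hat A\times\mathbb R\times[0,\infty)$, $f(z)=\hat f(\hat z)$, $s(\xi,z)=s(\xi,\hat z)$, $s^\nu(\xi,z)=s^\nu(\xi,\hat z)$, $\hat g_i(u,z)=\hat g_i(u,\hat z)$, $g_1(u,z)=\hat g_1(u,\hat z)$, $g_2(u,z)=\sigma+\gamma+\frac1{1-\alpha}\max\{0,\hat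 g_2(u,\hat z)-\gamma\}$, $G(\xi,z)=\big(g_1(s(\xi,z),z),g_2(s(\xi,z),z)\big)$ and $\psi(z)=\mathbb E\big[g_2(s(\boldsymbol\xi,z),z)\big]$. For a set $C$ let $\iota_C=0$ on $C$ and $\iota_C=\infty$ off $C$, and let $$\phi(z)=\iota_A(z)+f(z)+\mathbb E\big[g_1(s(\boldsymbol\xi,z),z)\big]+\iota_{\{0\}}(\psi(z)),\qquad z\in Z .$$ *Discretization.* For each $n$ let $\hat T_n:\mathbb R^n\to\hat Z$ be a mapping with range $\hat Z^n$, let $T_n:\mathbb R^n\times\mathbb R^2\to Z$ be $T_n(x,\gamma,\sigma)=(\hat T_n(x),\gamma,\sigma)$, with range $Z^n=\hat Z^n\times\mathbb R^2$, and let $A_n=T_n^{-1}(A)$ and $\phi_n=\phi\circ T_n$. *Approximating problems.* Let $\operatorname{smax}(t;\beta)=\beta\ln(1+e^{t/\beta})$, and let $y^\nu\in\mathbb R$, $\theta^\nu\in(0,\infty)$, $\beta^\nu\in(0,\infty)$. With $g_2^\nu(u,z)=\sigma+\gamma+\frac1{1-\alpha}\operatorname{smax}\big(\hat g_2(u,\hat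 z)-\gamma;\beta^\nu\big)$ and, for $z_n\in\mathbb R^n\times\mathbb R^2$ and $z=T_n(z_n)$, $$w_1=\frac1\nu\sum_{j=1}^\nu g_1\big(s^\nu(\boldsymbol\xi_j,z),z\big),\qquad w_2=\frac1\nu\sum_{j=1}^\nu g_2^\nu\big(s^\nu(\boldsymbol\xi_j,z),z\big),$$ put $\phi_n^\nu(z_n)=\iota_{A_n}(z_n)+f(z)+w_1+y^\nu w_2+\theta^\nu w_2^2$. For $\delta\in[0,\infty)$ and an extended-real-valued function $F$ let $\delta\text{-}\operatorname{argmin}F=\{x\mid F(x)<\infty,\ F(x)\le\inf F+\delta\}$. *Buffered failure probability.* For a random variable $\eta$ let $Q_a(\eta)=\min\{x\mid\operatorname{prob}(\eta\le x)\ge a\}$ and $\bar Q_a(\eta)=Q_a(\eta)+\frac1{1-a}\mathbb E\big[\max\{0,\eta-Q_a(\eta)\}\big]$, $a\in(0,1)$. Then $\mathrm{bPOE}(\eta>0)$ is $0$ if $\operatorname{prob}(\eta>0)=0$; it is $1-a$ with the unique $a\in(0,1)$ for which $\bar Q_a(\eta)=0$ if $\operatorname{prob}(\eta>0)>0$ and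 $\mathbb E[\eta]<0$; and it is $1$ otherwise. Here $\mathbb E[\eta]\in[-\infty,\infty]$, with value $\infty$ if the positive part of $\eta$ has infinite expectation. **Proposition (optimality gap under buffered probability constraint).** Fix $\bar n\in\mathbb N$. Suppose that: 1. $\tau:=\inf_Z\phi$ is finite, $A$ is closed and $f$ is continuous relative to $A$. 2. For each $\bar z\in A$, $G(\cdot,\bar z)$ is measurable and there are $\rho\in(0,\infty)$ and a $P$-integrable $c:\Xi\to[0,\infty)$ with $\|G(\xi,z)\|_\infty\le c(\xi)$ for all $\xi\in\Xi$ and all $z\in A$ with $\|z-\bar z\|_Z\le\rho$. 3. For every $z\in A$ with $\psi(z)=0$ there are $z^n\in A\cap Z^n$, defined for all large $n$, with $z^n\to z$ and $\psi(z^n)<0$. 4. For every $n\ge\bar n$, $\inf\phi_n<\infty$ and the following hold. - (Continuity.) $s(\xi,\cdot)$ is continuous for every $\xi\in\Xi$; $g_1$ and $g_2$ are continuous on $U\times Z$; $G(\cdot,T_n(z_n))$ is measurable for every $z_n$; $T_n$ is continuous. - (Local bounds.) For each $\bar z_n\in A_n$ there are $\rho\in(0,\infty)$ and a $P$-integrable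 $c:\Xi\to[0,\infty)$ with $\|G(\xi,T_n(z_n))\|_\infty\le c(\xi)$ for all $\xi\in\Xi$ and all $z_n\in\mathbb B(\bar z_n,\rho)\cap A_n$, where $\mathbb B(\bar z_n,\rho)$ is the closed ball. - (Solution properties.) There are $\eta,\kappa\in(0,\infty)$, $\lambda,\mu:\Xi\to[0,\infty)$, $\rho,\pi:A_n\to(0,\infty)$ and $\Delta_0,\Delta_\nu:A_n\to[0,\infty)$, $\nu\in\mathbb N$, such that $\mathbb E[\lambda^\eta(\boldsymbol\xi)\mu^\kappa(\boldsymbol\xi)]$ and $\mathbb E[\mu^\kappa(\boldsymbol\xi)]$ are finite; for all $z_n\in A_n$, $z=T_n(z_n)$, $\xi\in\Xi$, $u,u'\in U$, $\nu\in\mathbb N$ and $i\in\{1,2\}$, $$|g_i(u,z)-g_i(u',z)|\le\pi(z_n)\big(\|u\|_U^\eta+\|u'\|_U^\eta+1\big)\|u-u'\|_U^\kappa,$$ $$\max\{\|s(\xi,z)\|_U,\|s^\nu(\xi,z)\|_U\}\le\lambda(\xi)\Delta_0(z_n),\qquad\|s^\nu(\xi,z)-s(\xi,z)\|_U\le\mu(\xi)\Delta_\nu(z_n);$$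 and for every $\bar z_n\in A_n$, on $\mathbb B(\bar z_n,\rho(\bar z_n))\cap A_n$ the functions $\pi$ and $\Delta_0$ are bounded and $\Delta_\nu\to0$ uniformly as $\nu\to\infty$. - (Qualification.) For every $z_n\in A_n$ with $\psi(T_n(z_n))=0$ there are $z_n^\nu\in A_n$ with $z_n^\nu\to z_n$ as $\nu\to\infty$ and $\psi(T_n(z_n^\nu))<0$. 5. $\{y^\nu\}$ is bounded, $\theta^\nu\to\infty$ and $\beta^\nu\to0$. Then, with probability one, the following holds: for every $\epsilon\in(0,\infty)$ there is $n_\epsilon\ge\bar n$ such that, whenever $n\ge n_\epsilon$, $\delta^\nu\in[0,\infty)$, $\delta^\nu\to\delta\in[0,\infty)$, and $\bar z_n$ is a cluster point of a sequence with $\bar z_n^\nu\in\delta^\nu\text{-}\operatorname{argmin}\phi_n^\nu$ for all $\nu\in\mathbb N$, then $\bar z=T_n(\bar z_n)$ satisfies $\bar z\in A$, $$f(\bar z)+\mathbb E\big[\hat g_1(s(\boldsymbol\xi,\bar z),\bar z)\big]\le\tau+\epsilon+\delta\qquad\text{and}\qquad\mathrm{bPOE}\big(\hat g_2(s(\boldsymbol\xi,\bar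 z),\bar z)>0\big)\le1-\alpha .$$ -/

import Mathlib

open MeasureTheory ProbabilityTheory Filter Topology
open scoped NNReal

noncomputable section

namespace OUU

/-! ### Quantiles, superquantiles and the buffered failure probability -/

section Buffered

variable {S : Type*} [MeasurableSpace S]

/-- The (left) `a`-quantile `min {x | prob (η ≤ x) ≥ a}` of a random variable, for `0 < a < 1`. -/
def quantile (P : Measure S) (η : S → ℝ) (a : ℝ) : ℝ :=
  sInf {x : ℝ | a ≤ P.real {ξ | η ξ ≤ x}}

/-- The `a`-superquantile of a random variable. -/
def superquantile (P : Measure S) (η : S → ℝ) (a : ℝ) : ℝ :=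
  quantile P η a + 1 / (1 - a) * ∫ ξ, max 0 (η ξ - quantile P η a) ∂P

/-- The expectation in the extended reals, equal to `⊤` if the positive part integrates to infinity.
It is the usual expectation for a random variable with finite mean. -/
def extExpectation (P : Measure S) (η : S → ℝ) : EReal :=
  open Classical in
  if ∫⁻ ξ, ENNReal.ofReal (η ξ) ∂P = ⊤ then ⊤
  else ((∫⁻ ξ, ENNReal.ofReal (η ξ) ∂P : ENNReal) : EReal)
    - ((∫⁻ ξ, ENNReal.ofReal (-η ξ) ∂P : ENNReal) : EReal)

/-- The buffered failure probability `bPOE {η > 0}`. In the second case there is exactly one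
`a ∈ (0, 1)` whose `a`-superquantile vanishes, so that the infimum is this number. -/
def bPOE (P : Measure S) (η : S → ℝ) : ℝ :=
  open Classical in
  if P {ξ | 0 < η ξ} = 0 then 0
  else if extExpectation P η < 0 then
    1 - sInf {a : ℝ | a ∈ Set.Ioo (0 : ℝ) 1 ∧ superquantile P η a = 0}
  else 1

end Buffered

/-! ### Extended-real-valued minimization -/

section Minimization

variable {X : Type*}

/-- The indicator function of a set in the sense of optimization: `0` on the set, `∞` off it. -/
def ind (C : Set X) (x : X) : EReal :=
  open Classical in if x ∈ C then 0 else ⊤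

/-- The set of `δ`-near-minimizers of an extended-real-valued function. -/
def nearArgmin (δ : ℝ≥0) (F : X → EReal) : Set X :=
  {x | F x < ⊤ ∧ F x ≤ (⨅ x', F x') + (((δ : ℝ)) : EReal)}

/-- The objective function `ι_A + f + h ∘ w`, where `w` gives the (expected or averaged)
quantities of interest. -/
def objective {m : ℕ} (A : Set X) (f : X → ℝ) (h : (Fin m → ℝ) → EReal) (w : X → Fin m → ℝ)
    (x : X) : EReal :=
  ind A x + (f x : EReal) + h (w x)

end Minimization

/-! ### Optimization under uncertainty with a solution mapping: the general setting

`s ξ z` is the solution of the parametrized equation for the realization `ξ` and the control `z`;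
`T : X → Z` represents the discretized controls (those in the range of `T`) by the parameters in
`X`. -/

section General

variable {Ξ U Z X : Type*} {m : ℕ}

/-- The quantities of interest `G(ξ, z) = (g_1(s(ξ,z),z), …, g_m(s(ξ,z),z))`. -/
def quantities (g : Fin m → U → Z → ℝ) (s : Ξ → Z → U) (ξ : Ξ) (z : Z) : Fin m → ℝ :=
  fun i => g i (s ξ z) z

/-- `E[G(ξ, z)]`, componentwise. -/
def expected [MeasurableSpace Ξ] (P : Measure Ξ) (G : Ξ → Z → Fin m → ℝ) (z : Z) : Fin m → ℝ :=
  fun i => ∫ ξ, G ξ z i ∂P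

/-- The average of `G(·, z)` over the first `ν` sample points. -/
def sampleAverage (ξs : ℕ → Ξ) (ν : ℕ) (G : Ξ → Z → Fin m → ℝ) (z : Z) : Fin m → ℝ :=
  fun i => (1 / (ν : ℝ)) * ∑ j ∈ Finset.range ν, G (ξs j) z i

/-- Continuity assumption. Measurability in `ξ` is understood with respect to the completion of
`P`. -/
def ContinuityAssumption [MeasurableSpace Ξ] [TopologicalSpace U] [TopologicalSpace Z]
    [TopologicalSpace X] (P : Measure Ξ) (g : Fin m → U → Z → ℝ) (s : Ξ → Z → U) (T : X → Z) :
    Prop :=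
  (∀ ξ, Continuous (s ξ)) ∧
  (∀ i, Continuous fun p : U × Z => g i p.1 p.2) ∧
  (∀ x, AEMeasurable (fun ξ => quantities g s ξ (T x)) P) ∧
  Continuous T

/-- The performance functions are locally bounded, as functions of the parameters of discretized
controls. -/
def LocallyBoundedParam [MeasurableSpace Ξ] [PseudoMetricSpace X] (P : Measure Ξ)
    (G : Ξ → Z → Fin m → ℝ) (T : X → Z) (A : Set Z) : Prop :=
  ∀ xbar ∈ T ⁻¹' A, ∃ (ρ : ℝ) (c : Ξ → ℝ), 0 < ρ ∧ (∀ ξ, 0 ≤ c ξ) ∧ Integrable c P ∧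
    ∀ x ∈ Metric.closedBall xbar ρ ∩ T ⁻¹' A, ∀ ξ, ‖G ξ (T x)‖ ≤ c ξ

/-- The performance functions are measurable in `ξ` and locally bounded on the admissible set. -/
def LocallyBounded [MeasurableSpace Ξ] [SeminormedAddCommGroup Z] (P : Measure Ξ)
    (G : Ξ → Z → Fin m → ℝ) (A : Set Z) : Prop :=
  ∀ zbar ∈ A, AEMeasurable (fun ξ => G ξ zbar) P ∧
    ∃ (ρ : ℝ) (c : Ξ → ℝ), 0 < ρ ∧ (∀ ξ, 0 ≤ c ξ) ∧ Integrable c P ∧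
      ∀ z ∈ A, ‖z - zbar‖ ≤ ρ → ∀ ξ, ‖G ξ z‖ ≤ c ξ

/-- Solution properties and approximations: a Hölder-type condition on the performance functions,
bounds on the exact and approximate solutions, and bounds on the solution error that vanish locally
uniformly. -/
def SolutionAssumption [MeasurableSpace Ξ] [SeminormedAddCommGroup U] [PseudoMetricSpace X]
    (P : Measure Ξ) (g : Fin m → U → Z → ℝ) (s : Ξ → Z → U) (sν : ℕ → Ξ → Z → U) (T : X → Z)
    (A : Set Z) : Prop :=
  ∃ (η κ : ℝ) (lam mu : Ξ → ℝ) (ρ π Δ₀ : X → ℝ) (Δ : ℕ → X → ℝ),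
    0 < η ∧ 0 < κ ∧ (∀ ξ, 0 ≤ lam ξ ∧ 0 ≤ mu ξ) ∧
    (∀ x ∈ T ⁻¹' A, 0 < ρ x ∧ 0 < π x ∧ 0 ≤ Δ₀ x ∧ ∀ ν, 1 ≤ ν → 0 ≤ Δ ν x) ∧
    Integrable (fun ξ => lam ξ ^ η * mu ξ ^ κ) P ∧
    Integrable (fun ξ => mu ξ ^ κ) P ∧
    (∀ x ∈ T ⁻¹' A,
      (∀ i u u', |g i u (T x) - g i u' (T x)| ≤
        π x * (‖u‖ ^ η + ‖u'‖ ^ η + 1) * ‖u - u'‖ ^ κ) ∧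
      ∀ ξ ν, 1 ≤ ν →
        max ‖s ξ (T x)‖ ‖sν ν ξ (T x)‖ ≤ lam ξ * Δ₀ x ∧
        ‖sν ν ξ (T x) - s ξ (T x)‖ ≤ mu ξ * Δ ν x) ∧
    (∀ xbar ∈ T ⁻¹' A,
      BddAbove (π '' (Metric.closedBall xbar (ρ xbar) ∩ T ⁻¹' A)) ∧
      BddAbove (Δ₀ '' (Metric.closedBall xbar (ρ xbar) ∩ T ⁻¹' A)) ∧
      TendstoUniformlyOn Δ (fun _ => 0) atTop (Metric.closedBall xbar (ρ xbar) ∩ T ⁻¹' A))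

end General

/-! ### The problem with a buffered failure probability constraint

A control of the reformulated problem is a triple `z = (ẑ, γ, σ)`: the original control, a
threshold, and a nonnegative slack. -/

section BufferedProblem

variable {Ξ U Zh : Type*}

/-- The softplus function `smax(t; b) = b ln (1 + exp (t / b))`. -/
def smax (t b : ℝ) : ℝ := b * Real.log (1 + Real.exp (t / b))

/-- The admissible set `Â × ℝ × [0, ∞)`. -/
def admissible (Ah : Set Zh) : Set (Zh × ℝ × ℝ) := {z | z.1 ∈ Ah ∧ 0 ≤ z.2.2}

/-- The trivial extension of a solution mapping from `Ẑ` to `Ẑ × ℝ × ℝ`. -/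
def extSol (s : Ξ → Zh → U) (ξ : Ξ) (z : Zh × ℝ × ℝ) : U := s ξ z.1

/-- The parametrization `(x, γ, σ) ↦ (T̂ x, γ, σ)` of the discretized controls in
`Ẑⁿ × ℝ × ℝ`, where `Ẑⁿ` is the range of `T̂`. -/
def extParam {X : Type*} (T : X → Zh) (x : X × ℝ × ℝ) : Zh × ℝ × ℝ := (T x.1, x.2)

/-- The performance functions `g_1(u,z) = ĝ_1(u,ẑ)` and
`g_2(u,z) = σ + γ + max {0, ĝ_2(u,ẑ) - γ} / (1 - α)`. -/
def bufferedPerf (α : ℝ) (g₁ g₂ : U → Zh → ℝ) : Fin 2 → U → Zh × ℝ × ℝ → ℝ :=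
  ![fun u z => g₁ u z.1,
    fun u z => z.2.2 + z.2.1 + 1 / (1 - α) * max 0 (g₂ u z.1 - z.2.1)]

/-- The performance functions with `max {0, ·}` replaced by `smax(·; b)`. -/
def smoothedPerf (α b : ℝ) (g₁ g₂ : U → Zh → ℝ) : Fin 2 → U → Zh × ℝ × ℝ → ℝ :=
  ![fun u z => g₁ u z.1,
    fun u z => z.2.2 + z.2.1 + 1 / (1 - α) * smax (g₂ u z.1 - z.2.1) b]

/-- The monitoring function `h(w) = w_1 + ι_{0}(w_2)` of the equality-constrained problem. -/
def monitor (w : Fin 2 → ℝ) : EReal := (w 0 : EReal) + ind {(0 : ℝ)} (w 1)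

/-- The augmented Lagrangian `h^ν(w) = w_1 + y w_2 + θ w_2²`. -/
def augLagrangian (y θ : ℝ) (w : Fin 2 → ℝ) : EReal :=
  ((w 0 + y * w 1 + θ * w 1 ^ 2 : ℝ) : EReal)

/-- The quantities of interest of the buffered problem. -/
def bufferedQuantities (α : ℝ) (g₁ g₂ : U → Zh → ℝ) (s : Ξ → Zh → U) :
    Ξ → Zh × ℝ × ℝ → Fin 2 → ℝ :=
  quantities (bufferedPerf α g₁ g₂) (extSol s)

/-- The objective function `φ` of the problem
`min f̂(ẑ) + E[ĝ_1]` over `ẑ ∈ Â`, `γ ∈ ℝ`, `σ ≥ 0` subject to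
`E[σ + γ + max {0, ĝ_2 - γ} / (1 - α)] = 0`. -/
def bufferedObjective [MeasurableSpace Ξ] (P : Measure Ξ) (Ah : Set Zh) (f : Zh → ℝ)
    (g₁ g₂ : U → Zh → ℝ) (s : Ξ → Zh → U) (α : ℝ) : Zh × ℝ × ℝ → EReal :=
  objective (admissible Ah) (fun z => f z.1) monitor
    (expected P (bufferedQuantities α g₁ g₂ s))

/-- The objective function `φ_n^ν` of the approximating problem, as a function of the parameters
`(x, γ, σ)`: `T` is the parametrization of the discretized controls, `ξs` the sample, `ν` the sample
size, `sν` the approximate solution mapping, `b` the smoothing parameter, `y` the multiplier and `θ`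
the penalty parameter. -/
def approxObjective {X : Type*} (Ah : Set Zh) (f : Zh → ℝ) (g₁ g₂ : U → Zh → ℝ) (α : ℝ)
    (T : X → Zh) (ξs : ℕ → Ξ) (ν : ℕ) (sν : Ξ → Zh → U) (b y θ : ℝ) : X × ℝ × ℝ → EReal :=
  objective (extParam T ⁻¹' admissible Ah) (fun x => f (extParam T x).1) (augLagrangian y θ)
    (fun x => sampleAverage ξs ν (quantities (smoothedPerf α b g₁ g₂) (extSol sν)) (extParam T x))

/-- `ψ(z) = E[σ + γ + max {0, ĝ_2(s(ξ,ẑ),ẑ) - γ} / (1 - α)]`. -/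
def constraintMean [MeasurableSpace Ξ] (P : Measure Ξ) (g₂ : U → Zh → ℝ) (s : Ξ → Zh → U) (α : ℝ)
    (z : Zh × ℝ × ℝ) : ℝ :=
  ∫ ξ, (z.2.2 + z.2.1 + 1 / (1 - α) * max 0 (g₂ (s ξ z.1) z.1 - z.2.1)) ∂P

/-- Constraint qualification at a fixed discretization level: every admissible parameter with
`ψ = 0` is a limit of admissible parameters with `ψ < 0`. -/
def ParamQualification [MeasurableSpace Ξ] {X : Type*} [TopologicalSpace X] (P : Measure Ξ)
    (Ah : Set Zh) (g₂ : U → Zh → ℝ) (s : Ξ → Zh → U) (α : ℝ) (T : X → Zh) : Prop :=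
  ∀ x ∈ extParam T ⁻¹' admissible Ah, constraintMean P g₂ s α (extParam T x) = 0 →
    ∃ w : ℕ → X × ℝ × ℝ, Tendsto w atTop (𝓝 x) ∧
      ∀ k, w k ∈ extParam T ⁻¹' admissible Ah ∧ constraintMean P g₂ s α (extParam T (w k)) < 0

/-- Constraint qualification across discretization levels: every admissible control with `ψ = 0` is
the limit of admissible discretized controls, one for each large `n`, with `ψ < 0`. -/
def ControlQualification [MeasurableSpace Ξ] [TopologicalSpace Zh] {X : ℕ → Type*} (P : Measure Ξ)
    (Ah : Set Zh) (g₂ : U → Zh → ℝ) (s : Ξ → Zh → U) (α : ℝ) (T : ∀ n, X n → Zh) : Prop :=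
  ∀ z ∈ admissible Ah, constraintMean P g₂ s α z = 0 →
    ∃ w : ℕ → Zh × ℝ × ℝ, Tendsto w atTop (𝓝 z) ∧
      ∀ᶠ n in atTop, w n ∈ admissible Ah ∩ Set.range (extParam (T n)) ∧
        constraintMean P g₂ s α (w n) < 0

end BufferedProblem

end OUU

end

/-!
The argument combines continuous convergence of the sample averages, the penalty effect of the
augmented Lagrangian, and the Rockafellar–Uryasev description of superquantiles.

*Continuous convergence.* With probability one, the averages of the smoothed performance functions
at the approximate solutions converge continuously, as the sample size grows and the parameter
approaches an admissible limit, to the expected quantities of interest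
(`tendsto_sampleAverage_smoothed`). Replacing `smax(·; b)` by `max {0, ·}` costs at most `b log 2`
times a constant, the approximate solutions are handled by the Hölder-type bounds and the strong law
for `λ^η μ^κ` and `μ^κ`, and the exact quantities obey a uniform law of large numbers
(`tendsto_sampleAverage`). The latter needs neither compactness nor measurability of uncountable
suprema: an average over parameters in a basic open set is bounded by the average of the supremum
over that set, which is a supremum over countably many parameters by continuity.

*Cluster points.* Let `x'` be an admissible parameter with `ψ < 0`. For large samples its averaged
constraint is negative, and raising the slack `σ` makes it exactly zero without changing the cost,
so that the multiplier and penalty terms disappear. Compared with this competitor, the penalty term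
of near-minimizers stays bounded, which forces `ψ = 0` at their cluster points, where the cost is at
most that of `x'` plus `δ` (`mapClusterPt_nearArgmin`). By the constraint qualification across
discretization levels, for all large `n` there is such an `x'` whose cost is below `τ + ε`
(`exists_strictlyFeasible_of_controlQualification`). This gives the bound on the cost.

*Buffered failure probability.* Feasibility, `ψ = 0` with `σ ≥ 0`, says that
`γ + E[max {0, η - γ}] / (1 - α) ≤ 0` for `η = ĝ_2(s(ξ,ẑ),ẑ)`. As the superquantile minimizes this
expression over `γ`, a superquantile of level below `α` is then negative unless `η ≤ 0` almost
surely. A level at which the superquantile vanishes exists: it is `1 - min E[max {0, l η + 1}]` over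
`l ≥ 0` (`bPOE_le_of_ruFunction_nonpos`).
-/

namespace OUU

/-! ### Superquantiles and the buffered failure probability -/

section Buffered

variable {S : Type*} [MeasurableSpace S] {P : Measure S} {η : S → ℝ} {a : ℝ}

/-- The Rockafellar–Uryasev function `γ ↦ γ + E[max {0, η - γ}] / (1 - a)`, whose minimum over `γ`
is the `a`-superquantile of `η`. -/
noncomputable def ruFunction (P : Measure S) (η : S → ℝ) (a γ : ℝ) : ℝ :=
  γ + 1 / (1 - a) * ∫ ξ, max 0 (η ξ - γ) ∂P

theorem integrable_max_mul_add [IsProbabilityMeasure P] (hη : AEMeasurable η P)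
    (hint : Integrable (fun ξ => max 0 (η ξ)) P) {l : ℝ} (hl : 0 ≤ l) (c : ℝ) :
    Integrable (fun ξ => max 0 (l * η ξ + c)) P := by
  refine ((hint.const_mul l).add (integrable_const |c|)).mono'
    (aemeasurable_const.max ((hη.const_mul l).add_const c)).aestronglyMeasurable
    (Eventually.of_forall fun ξ => ?_)
  rw [Real.norm_of_nonneg (le_max_left _ _)]
  have h1 := mul_le_mul_of_nonneg_left (le_max_right 0 (η ξ)) hl
  have h2 := mul_nonneg hl (le_max_left 0 (η ξ))
  simp only [Pi.add_apply]
  exact max_le (by positivity) (add_le_add h1 (le_abs_self c))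

theorem integrable_max_sub [IsProbabilityMeasure P] (hη : AEMeasurable η P)
    (hint : Integrable (fun ξ => max 0 (η ξ)) P) (γ : ℝ) :
    Integrable (fun ξ => max 0 (η ξ - γ)) P := by
  simpa [sub_eq_add_neg] using integrable_max_mul_add hη hint zero_le_one (-γ)

/-- The subgradient inequality of the Rockafellar–Uryasev function at `x`, with the subgradient
`1 - prob (η > x) / (1 - a)`. -/
theorem ruFunction_subgradient [IsProbabilityMeasure P] (hη : AEMeasurable η P)
    (hint : Integrable (fun ξ => max 0 (η ξ)) P) (ha : a < 1) (γ x : ℝ) :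
    ruFunction P η a x + (x - γ) * ((1 - P.real {ξ | η ξ ≤ x}) / (1 - a) - 1)
      ≤ ruFunction P η a γ := by
  have hm : NullMeasurableSet {ξ | η ξ ≤ x} P := nullMeasurableSet_le hη aemeasurable_const
  have hc : P.real {ξ | η ξ ≤ x}ᶜ = 1 - P.real {ξ | η ξ ≤ x} := by
    rw [measureReal_compl₀ hm]; simp
  have hi : Integrable (({ξ | η ξ ≤ x}ᶜ).indicator fun _ => (x - γ)) P :=
    (integrable_const _).indicator₀ hm.compl
  have key : (∫ ξ, max 0 (η ξ - x) ∂P) + (1 - P.real {ξ | η ξ ≤ x}) * (x - γ)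
      ≤ ∫ ξ, max 0 (η ξ - γ) ∂P := by
    have h1 : ∫ ξ, ({ξ | η ξ ≤ x}ᶜ).indicator (fun _ => (x - γ)) ξ ∂P
        = (1 - P.real {ξ | η ξ ≤ x}) * (x - γ) := by
      rw [integral_indicator₀ hm.compl, setIntegral_const, hc, smul_eq_mul]
    rw [← h1, ← integral_add (integrable_max_sub hη hint x) hi]
    refine integral_mono ((integrable_max_sub hη hint x).add hi) (integrable_max_sub hη hint γ)
      fun ξ => ?_
    by_cases h : η ξ ≤ x
    · simp [h]
    · have hlt : x < η ξ := not_le.mp h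
      have h2 : max 0 (η ξ - x) = η ξ - x := max_eq_right (by linarith)
      have h3 : ξ ∈ {ξ | η ξ ≤ x}ᶜ := h
      simp only [Set.indicator_of_mem h3, h2]
      exact le_trans (by linarith) (le_max_right _ _)
  have h1a : 0 < 1 - a := by linarith
  have h4 := mul_le_mul_of_nonneg_left key (show 0 ≤ 1 / (1 - a) by positivity)
  have h5 : (x - γ) * ((1 - P.real {ξ | η ξ ≤ x}) / (1 - a) - 1)
      = 1 / (1 - a) * ((1 - P.real {ξ | η ξ ≤ x}) * (x - γ)) - (x - γ) := by ring
  unfold ruFunction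
  rw [h5]
  linarith

theorem continuous_ruFunction [IsProbabilityMeasure P] (hη : AEMeasurable η P)
    (hint : Integrable (fun ξ => max 0 (η ξ)) P) : Continuous (ruFunction P η a) := by
  refine continuous_id.add (continuous_const.mul ?_)
  refine continuous_iff_continuousAt.mpr fun γ => ?_
  refine continuousAt_of_dominated (bound := fun ξ => max 0 (η ξ - (γ - 1)))
    (Eventually.of_forall fun x => (integrable_max_sub hη hint x).aestronglyMeasurable) ?_
    (integrable_max_sub hη hint _) (Eventually.of_forall fun ξ => by fun_prop)
  filter_upwards [lt_mem_nhds (show γ - 1 < γ by linarith)] with x hx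
  refine Eventually.of_forall fun ξ => ?_
  rw [Real.norm_of_nonneg (le_max_left _ _)]
  exact max_le_max le_rfl (by linarith)

theorem superquantile_eq_ruFunction : superquantile P η a = ruFunction P η a (quantile P η a) := rfl

/-- The quantile minimizes the Rockafellar–Uryasev function. -/
theorem superquantile_le_ruFunction [IsProbabilityMeasure P] (hη : AEMeasurable η P)
    (hint : Integrable (fun ξ => max 0 (η ξ)) P) (ha : a ∈ Set.Ioo (0 : ℝ) 1) (γ : ℝ) :
    superquantile P η a ≤ ruFunction P η a γ := by
  have h1a : 0 < 1 - a := by linarith [ha.2]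
  have hmono : ∀ x y : ℝ, x ≤ y → P.real {ξ | η ξ ≤ x} ≤ P.real {ξ | η ξ ≤ y} := fun x y hxy =>
    measureReal_mono fun ξ (hξ : η ξ ≤ x) => le_trans hξ hxy
  have : IsProbabilityMeasure (P.map η) := Measure.isProbabilityMeasure_map hη
  have hcdf : ∀ x : ℝ, cdf (P.map η) x = P.real {ξ | η ξ ≤ x} := fun x => by
    rw [cdf_eq_real, map_measureReal_apply_of_aemeasurable hη measurableSet_Iic]; rfl
  have hne : {x : ℝ | a ≤ P.real {ξ | η ξ ≤ x}}.Nonempty := by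
    obtain ⟨x, hx⟩ := ((tendsto_cdf_atTop (P.map η)).eventually (lt_mem_nhds ha.2)).exists
    exact ⟨x, by rw [Set.mem_ofPred_eq, ← hcdf]; exact hx.le⟩
  have hbd : BddBelow {x : ℝ | a ≤ P.real {ξ | η ξ ≤ x}} := by
    obtain ⟨x, hx⟩ := ((tendsto_cdf_atBot (P.map η)).eventually (gt_mem_nhds ha.1)).exists
    refine ⟨x, fun y hy => le_of_not_gt fun hlt => ?_⟩
    have := hmono y x hlt.le
    rw [hcdf] at hx
    exact absurd (le_trans hy this) (not_le.mpr hx)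
  rw [superquantile_eq_ruFunction]
  have hq : quantile P η a = sInf {x : ℝ | a ≤ P.real {ξ | η ξ ≤ x}} := rfl
  set q := quantile P η a
  have hcont := (continuous_ruFunction (a := a) hη hint).tendsto q
  -- On either side of `q`, the subgradient at a point between `γ` and `q` has a known sign.
  rcases lt_trichotomy γ q with h | h | h
  · refine le_of_tendsto (hcont.mono_left nhdsWithin_le_nhds : Tendsto _ (𝓝[<] q) _) ?_
    filter_upwards [Ioo_mem_nhdsLT h] with x hx
    have h1 : P.real {ξ | η ξ ≤ x} < a := lt_of_not_ge fun h' =>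
      absurd (csInf_le hbd h') (not_le.mpr (hq ▸ hx.2))
    have h2 : 1 ≤ (1 - P.real {ξ | η ξ ≤ x}) / (1 - a) := by
      rw [le_div_iff₀ h1a]; linarith
    have h3 := ruFunction_subgradient hη hint ha.2 γ x
    have h4 : 0 ≤ (x - γ) * ((1 - P.real {ξ | η ξ ≤ x}) / (1 - a) - 1) :=
      mul_nonneg (by linarith [hx.1]) (by linarith)
    linarith
  · rw [h]
  · refine le_of_tendsto (hcont.mono_left nhdsWithin_le_nhds : Tendsto _ (𝓝[>] q) _) ?_
    filter_upwards [Ioo_mem_nhdsGT h] with x hx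
    have h1 : a ≤ P.real {ξ | η ξ ≤ x} := by
      obtain ⟨y, hy, hyx⟩ := exists_lt_of_csInf_lt hne (hq ▸ hx.1)
      exact le_trans hy (hmono y x hyx.le)
    have h2 : (1 - P.real {ξ | η ξ ≤ x}) / (1 - a) ≤ 1 := by
      rw [div_le_one h1a]; linarith
    have h3 := ruFunction_subgradient hη hint ha.2 γ x
    have h4 : 0 ≤ (x - γ) * ((1 - P.real {ξ | η ξ ≤ x}) / (1 - a) - 1) :=
      mul_nonneg_of_nonpos_of_nonpos (by linarith [hx.2]) (by linarith)
    linarith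

/-- A random variable that is positive with positive probability and whose Rockafellar–Uryasev
function takes a negative argument to a nonpositive value has a vanishing superquantile: its level
is `1 - min E[max {0, l η + 1}]` over `l ≥ 0`. -/
theorem exists_superquantile_eq_zero [IsProbabilityMeasure P] (hη : AEMeasurable η P)
    (hint : Integrable (fun ξ => max 0 (η ξ)) P) (hpos : P {ξ | 0 < η ξ} ≠ 0)
    (ha : a ∈ Set.Ioo (0 : ℝ) 1) {γ : ℝ} (hγ : γ < 0) (h : ruFunction P η a γ ≤ 0) :
    ∃ a' ∈ Set.Ioo (0 : ℝ) 1, superquantile P η a' = 0 := by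
  set b : ℝ → ℝ := fun l => ∫ ξ, max 0 (l * η ξ + 1) ∂P with hb
  have hI : ∀ l, 0 ≤ l → Integrable (fun ξ => max 0 (l * η ξ + 1)) P := fun l hl =>
    integrable_max_mul_add hη hint hl 1
  have hp : 0 < ∫ ξ, max 0 (η ξ) ∂P := by
    rw [integral_pos_iff_support_of_nonneg (f := fun ξ => max 0 (η ξ))
      (fun ξ => le_max_left _ _) hint]
    refine lt_of_lt_of_le (pos_iff_ne_zero.mpr hpos) (measure_mono fun ξ (hξ : 0 < η ξ) => ?_)
    exact (lt_max_of_lt_right hξ).ne'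
  set p := ∫ ξ, max 0 (η ξ) ∂P
  have hblow : ∀ l, 0 ≤ l → l * p ≤ b l := fun l hl => by
    rw [hb, ← integral_const_mul]
    refine integral_mono (hint.const_mul l) (hI l hl) fun ξ => ?_
    rcases le_total 0 (η ξ) with h0 | h0
    · simp only [max_eq_right h0]
      exact le_trans (by linarith) (le_max_right _ _)
    · simp [max_eq_left h0]
  -- Division of `(η - x)⁺` by `-x > 0` relates `b` and the Rockafellar–Uryasev function.
  have hscale : ∀ x, x < 0 → ∫ ξ, max 0 (η ξ - x) ∂P = -x * b (-1 / x) := fun x hx => by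
    rw [hb, ← integral_const_mul]
    refine integral_congr_ae (Eventually.of_forall fun ξ => ?_)
    simp only
    rw [mul_max_of_nonneg _ _ (by linarith : 0 ≤ -x), mul_zero]
    have hx0 : x ≠ 0 := hx.ne
    congr 1
    field_simp
    ring
  have h1a : 0 < 1 - a := by linarith [ha.2]
  have hl0 : 0 < -1 / γ := div_pos_of_neg_of_neg (by norm_num) hγ
  have hbl0 : b (-1 / γ) ≤ 1 - a := by
    unfold ruFunction at h
    rw [hscale γ hγ] at h
    have h2 : -γ * b (-1 / γ) ≤ -γ * (1 - a) := by
      have h3 : 1 / (1 - a) * (-γ * b (-1 / γ)) ≤ -γ := by linarith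
      rwa [one_div, inv_mul_le_iff₀ h1a, mul_comm (1 - a)] at h3
    exact le_of_mul_le_mul_left h2 (by linarith)
  have hl0p : -1 / γ ≤ 1 / p := by
    rw [le_div_iff₀ hp]
    linarith [hblow _ hl0.le, ha.1]
  have hcont : ContinuousOn b (Set.Icc 0 (1 / p)) := by
    refine continuousOn_of_dominated (bound := fun ξ => max 0 (1 / p * max 0 (η ξ) + 1))
      (fun l hl => (hI l hl.1).aestronglyMeasurable) (fun l hl => Eventually.of_forall fun ξ => ?_)
      ?_ (Eventually.of_forall fun ξ => by fun_prop)
    · rw [Real.norm_of_nonneg (le_max_left _ _)]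
      have h2 := mul_le_mul_of_nonneg_left (le_max_right 0 (η ξ)) hl.1
      have h3 := mul_le_mul_of_nonneg_right hl.2 (le_max_left 0 (η ξ))
      exact max_le_max le_rfl (by linarith)
    · refine integrable_max_mul_add (aemeasurable_const.max hη) ?_ (by positivity) 1
      simpa using hint
  obtain ⟨l, hl, hmin⟩ := isCompact_Icc.exists_isMinOn ⟨_, hl0.le, hl0p⟩ hcont
  have hlle : b l ≤ b (-1 / γ) := hmin ⟨hl0.le, hl0p⟩
  have hglob : ∀ x, 0 ≤ x → b l ≤ b x := fun x hx => by
    rcases le_total x (1 / p) with h2 | h2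
    · exact hmin ⟨hx, h2⟩
    · have h3 : 1 ≤ x * p := by rwa [div_le_iff₀ hp] at h2
      linarith [hblow x hx, ha.1]
  have hlpos : 0 < l := by
    refine lt_of_le_of_ne hl.1 fun h0 => ?_
    have h2 : b l = 1 := by simp [hb, ← h0]
    linarith [ha.1]
  have hblpos : 0 < b l := lt_of_lt_of_le (mul_pos hlpos hp) (hblow l hlpos.le)
  have hmem : 1 - b l ∈ Set.Ioo (0 : ℝ) 1 := ⟨by linarith [ha.1], by linarith⟩
  refine ⟨1 - b l, hmem, le_antisymm ?_ ?_⟩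
  · refine (superquantile_le_ruFunction hη hint hmem (-1 / l)).trans (le_of_eq ?_)
    have hneg : -1 / l < 0 := div_neg_of_neg_of_pos (by norm_num) hlpos
    have h4 : -1 / (-1 / l) = l := by field_simp
    unfold ruFunction
    have hb0 : b l ≠ 0 := hblpos.ne'
    have h5 : 1 - (1 - b l) = b l := by ring
    rw [hscale _ hneg, h4, h5]
    generalize b l = t at hb0
    field_simp
    ring
  · rw [superquantile_eq_ruFunction]
    set q := quantile P η (1 - b l)
    unfold ruFunction
    have h5 : 1 - (1 - b l) = b l := by ring
    rw [h5]
    rcases lt_or_ge q 0 with hq | hq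
    · rw [hscale q hq]
      have h6 := hglob (-1 / q) (div_pos_of_neg_of_neg (by norm_num) hq).le
      have h7 : 1 ≤ 1 / b l * b (-1 / q) := by
        rw [one_div, ← div_eq_inv_mul, le_div_iff₀ hblpos]; linarith
      nlinarith
    · have : 0 ≤ ∫ ξ, max 0 (η ξ - q) ∂P := integral_nonneg fun ξ => le_max_left _ _
      positivity

/-- From `η - γ ≤ max {0, η - γ}` one gets `E[η] ≤ a γ < 0`. The inequality is rearranged so that
only expectations of nonnegative variables occur, as the negative part of `η` need not be
integrable. -/
theorem extExpectation_neg [IsProbabilityMeasure P] (hη : AEMeasurable η P)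
    (hint : Integrable (fun ξ => max 0 (η ξ)) P) (ha : a ∈ Set.Ioo (0 : ℝ) 1) {γ : ℝ} (hγ : γ < 0)
    (h : ruFunction P η a γ ≤ 0) : extExpectation P η < 0 := by
  have h1a : 0 < 1 - a := by linarith [ha.2]
  have hof : ∀ t : ℝ, ENNReal.ofReal (max 0 t) = ENNReal.ofReal t := fun t => by
    rcases le_total 0 t with h0 | h0
    · rw [max_eq_right h0]
    · rw [max_eq_left h0, ENNReal.ofReal_of_nonpos h0, ENNReal.ofReal_zero]
  have hfin : ∫⁻ ξ, ENNReal.ofReal (η ξ) ∂P ≠ ⊤ := by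
    have := ofReal_integral_eq_lintegral_ofReal hint
      (Eventually.of_forall fun ξ => le_max_left _ _)
    simp only [hof] at this
    rw [← this]
    exact ENNReal.ofReal_ne_top
  have hγI : ∫⁻ ξ, ENNReal.ofReal (η ξ - γ) ∂P ≤ ENNReal.ofReal ((1 - a) * -γ) := by
    have h2 := ofReal_integral_eq_lintegral_ofReal (integrable_max_sub hη hint γ)
      (Eventually.of_forall fun ξ => le_max_left _ _)
    simp only [hof] at h2
    rw [← h2]
    refine ENNReal.ofReal_le_ofReal ?_
    unfold ruFunction at h
    have h3 : 1 / (1 - a) * ∫ ξ, max 0 (η ξ - γ) ∂P ≤ -γ := by linarith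
    rwa [one_div, inv_mul_le_iff₀ h1a] at h3
  have hsum : (∫⁻ ξ, ENNReal.ofReal (η ξ) ∂P) + ENNReal.ofReal (-γ)
      ≤ ENNReal.ofReal ((1 - a) * -γ) + ∫⁻ ξ, ENNReal.ofReal (-η ξ) ∂P := by
    refine le_trans ?_ (add_le_add_left hγI _)
    have h4 : ENNReal.ofReal (-γ) = ∫⁻ _, ENNReal.ofReal (-γ) ∂P := by simp
    rw [h4, ← lintegral_add_right _ measurable_const,
      ← lintegral_add_left' (hη.sub_const γ).ennreal_ofReal]
    refine lintegral_mono fun ξ => ?_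
    rcases le_total 0 (η ξ) with h0 | h0
    · rw [← ENNReal.ofReal_add h0 (by linarith)]
      exact le_trans (le_of_eq (by congr 1)) le_self_add
    · rw [ENNReal.ofReal_of_nonpos h0, zero_add]
      refine le_trans (ENNReal.ofReal_le_ofReal ?_) ENNReal.ofReal_add_le
      linarith
  have hlt : ∫⁻ ξ, ENNReal.ofReal (η ξ) ∂P < ∫⁻ ξ, ENNReal.ofReal (-η ξ) ∂P := by
    have h5 : ENNReal.ofReal (-γ) = ENNReal.ofReal (a * -γ) + ENNReal.ofReal ((1 - a) * -γ) := by
      rw [← ENNReal.ofReal_add (mul_nonneg ha.1.le (by linarith))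
        (mul_nonneg h1a.le (by linarith))]
      congr 1; ring
    rw [h5, ← add_assoc, add_comm (ENNReal.ofReal ((1 - a) * -γ)),
      ENNReal.add_le_add_iff_right ENNReal.ofReal_ne_top] at hsum
    refine lt_of_lt_of_le (ENNReal.lt_add_right hfin ?_) hsum
    exact (ENNReal.ofReal_pos.mpr (mul_pos ha.1 (by linarith))).ne'
  unfold extExpectation
  rw [if_neg hfin, EReal.sub_neg (Or.inl (by simpa using hfin)) (Or.inl (by simp))]
  exact_mod_cast hlt

/-- If the Rockafellar–Uryasev function of level `a` takes a nonpositive value, then the buffered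
failure probability is at most `1 - a`. -/
theorem bPOE_le_of_ruFunction_nonpos [IsProbabilityMeasure P] (hη : AEMeasurable η P)
    (hint : Integrable (fun ξ => max 0 (η ξ)) P) (ha : a ∈ Set.Ioo (0 : ℝ) 1) {γ : ℝ}
    (h : ruFunction P η a γ ≤ 0) : bPOE P η ≤ 1 - a := by
  have h1a : 0 < 1 - a := by linarith [ha.2]
  unfold bPOE
  split_ifs with h0 h1
  · exact h1a.le
  all_goals
    have hγ0 : γ < 0 := by
      have hI0 : 0 ≤ ∫ ξ, max 0 (η ξ - γ) ∂P := integral_nonneg fun ξ => le_max_left _ _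
      have hprod : 0 ≤ 1 / (1 - a) * ∫ ξ, max 0 (η ξ - γ) ∂P := by positivity
      unfold ruFunction at h
      refine lt_of_le_of_ne (by linarith) fun hγ => h0 ?_
      subst hγ
      simp only [sub_zero, zero_add] at h hprod
      have hz : ∫ ξ, max 0 (η ξ) ∂P = 0 := by
        rcases mul_eq_zero.mp (le_antisymm h hprod) with h' | h'
        · exact absurd h' (by positivity)
        · exact h'
      rw [integral_eq_zero_iff_of_nonneg (f := fun ξ => max 0 (η ξ)) (fun ξ => le_max_left _ _) hint]
        at hz
      refine measure_mono_null ?_ (ae_iff.mp hz)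
      intro ξ (hξ : 0 < η ξ) hξ'
      exact absurd hξ' (lt_max_of_lt_right hξ).ne'
  · obtain ⟨a', ha', hz⟩ := exists_superquantile_eq_zero hη hint h0 ha hγ0 h
    have : a ≤ sInf {a : ℝ | a ∈ Set.Ioo (0 : ℝ) 1 ∧ superquantile P η a = 0} := by
      refine le_csInf ⟨a', ha', hz⟩ fun c ⟨hc, hcz⟩ => le_of_not_gt fun hca => ?_
      -- For `c < a`, the value at `γ` of the function of level `c` would be negative.
      have h2 := superquantile_le_ruFunction hη hint hc γ
      have h1c : 0 < 1 - c := by linarith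
      unfold ruFunction at h h2
      have h3 : 1 / (1 - a) * ∫ ξ, max 0 (η ξ - γ) ∂P ≤ -γ := by linarith
      rw [one_div, inv_mul_le_iff₀ h1a] at h3
      have h4 : -γ ≤ 1 / (1 - c) * ∫ ξ, max 0 (η ξ - γ) ∂P := by linarith
      rw [one_div, ← div_eq_inv_mul, le_div_iff₀ h1c] at h4
      nlinarith
    linarith
  · exact absurd (extExpectation_neg hη hint ha hγ0 h) h1

end Buffered

/-! ### A uniform law of large numbers -/

section LargeNumbers

variable {Ω Ξ X : Type*} [MeasurableSpace Ω] {Pr : Measure Ω} [MeasurableSpace Ξ] {P : Measure Ξ}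
  {ξs : ℕ → Ω → Ξ}

/-- The strong law of large numbers for an integrable function of an iid sample. -/
theorem strong_law_sample (hmeas : ∀ j, Measurable (ξs j)) (hlaw : ∀ j, Pr.map (ξs j) = P)
    (hindep : iIndepFun ξs Pr) {h : Ξ → ℝ} (hh : Integrable h P) :
    ∀ᵐ ω ∂Pr, Tendsto (fun ν : ℕ => 1 / (ν : ℝ) * ∑ j ∈ Finset.range ν, h (ξs j ω)) atTop
      (𝓝 (∫ ξ, h ξ ∂P)) := by
  obtain ⟨k, hm, hk⟩ := hh.1.aemeasurable
  have hint : Integrable k P := hh.congr hk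
  have hid : ∀ j, IdentDistrib (k ∘ ξs j) (k ∘ ξs 0) Pr Pr := fun j =>
    IdentDistrib.comp ⟨(hmeas j).aemeasurable, (hmeas 0).aemeasurable, by rw [hlaw, hlaw]⟩ hm
  have hint0 : Integrable (k ∘ ξs 0) Pr :=
    Integrable.comp_measurable (by rwa [hlaw]) (hmeas 0)
  have hE : ∫ ω, (k ∘ ξs 0) ω ∂Pr = ∫ ξ, h ξ ∂P := by
    rw [integral_congr_ae hk, ← hlaw 0,
      integral_map (hmeas 0).aemeasurable hm.aestronglyMeasurable]
    simp only [Function.comp_apply]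
  have hslln := strong_law_ae_real (fun j => k ∘ ξs j) hint0
    (fun i j hij => (hindep.comp (fun _ => k) (fun _ => hm)).indepFun hij) hid
  rw [hE] at hslln
  have heq : ∀ᵐ ω ∂Pr, ∀ j, h (ξs j ω) = k (ξs j ω) := by
    rw [ae_all_iff]
    intro j
    exact ae_of_ae_map (hmeas j).aemeasurable (by rw [hlaw]; exact hk)
  filter_upwards [hslln, heq] with ω h1 h2
  refine h1.congr fun ν => ?_
  simp only [h2, Function.comp_apply]
  ring

/-- Averages of an integrand over an iid sample are asymptotically bounded from above, locally
uniformly, by the expectation. The average over the sample of the supremum of the integrand on a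
basic open set obeys the strong law, and its expectation is close to that of the integrand if the
open set is small. -/
theorem sampleAverage_lt_eventually [TopologicalSpace X] [SecondCountableTopology X]
    (hmeas : ∀ j, Measurable (ξs j)) (hlaw : ∀ j, Pr.map (ξs j) = P) (hindep : iIndepFun ξs Pr)
    {F : Ξ → X → ℝ} (hF : ∀ ξ, Continuous (F ξ)) (hFm : ∀ x, AEMeasurable (fun ξ => F ξ x) P)
    (hdom : ∀ x, ∃ c : Ξ → ℝ, Integrable c P ∧ ∀ᶠ x' in 𝓝 x, ∀ ξ, |F ξ x'| ≤ c ξ) :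
    ∀ᵐ ω ∂Pr, ∀ x, ∀ r, ∫ ξ, F ξ x ∂P < r → ∀ᶠ p : ℕ × X in atTop ×ˢ 𝓝 x,
      1 / (p.1 : ℝ) * ∑ j ∈ Finset.range p.1, F (ξs j ω) p.2 < r := by
  classical
  obtain ⟨D, hDc, hDd⟩ := TopologicalSpace.exists_countable_dense X
  set B := TopologicalSpace.countableBasis X
  set Sup : Set X → Ξ → ℝ := fun V ξ => ⨆ d : ↥(V ∩ D), F ξ d with hSup
  have hBb := TopologicalSpace.isBasis_countableBasis X
  have hSm : ∀ V, AEMeasurable (Sup V) P := fun V => by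
    have : Countable ↥(V ∩ D) := (hDc.mono Set.inter_subset_right).to_subtype
    exact AEMeasurable.iSup fun d : ↥(V ∩ D) => hFm d
  -- Countably many suprema satisfy the strong law simultaneously.
  have hall : ∀ᵐ ω ∂Pr, ∀ V ∈ B, Integrable (Sup V) P →
      Tendsto (fun ν : ℕ => 1 / (ν : ℝ) * ∑ j ∈ Finset.range ν, Sup V (ξs j ω)) atTop
        (𝓝 (∫ ξ, Sup V ξ ∂P)) := by
    rw [ae_ball_iff (TopologicalSpace.countable_countableBasis X)]
    intro V _
    by_cases hV : Integrable (Sup V) P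
    · filter_upwards [strong_law_sample hmeas hlaw hindep hV] with ω h _ using h
    · exact Eventually.of_forall fun ω h => absurd h hV
  filter_upwards [hall] with ω hω x r hr
  obtain ⟨c, hc, hcx⟩ := hdom x
  obtain ⟨W, hW⟩ := (𝓝 x).exists_antitone_basis
  obtain ⟨W₀, hW₀c, hW₀o, hxW₀⟩ := eventually_nhds_iff.mp hcx
  -- A decreasing sequence of basic neighbourhoods of `x` on which the integrand is dominated.
  have hV : ∀ k, ∃ V ∈ B, x ∈ V ∧ V ⊆ W k ∩ W₀ := fun k =>
    hBb.mem_nhds_iff.mp (inter_mem (hW.1.mem_of_mem trivial) (hW₀o.mem_nhds hxW₀))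
  choose V hVB hxV hVW using hV
  have hne : ∀ k, Nonempty ↥(V k ∩ D) := fun k =>
    (hDd.inter_open_nonempty _ (hBb.isOpen (hVB k)) ⟨x, hxV k⟩).to_subtype
  have hbound : ∀ k ξ, ∀ d : ↥(V k ∩ D), |F ξ d| ≤ c ξ := fun k ξ d =>
    hW₀c _ (hVW k d.2.1).2 ξ
  have hbdd : ∀ k ξ, BddAbove (Set.range fun d : ↥(V k ∩ D) => F ξ d) := fun k ξ =>
    ⟨c ξ, by rintro _ ⟨d, rfl⟩; exact (abs_le.mp (hbound k ξ d)).2⟩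
  have habs : ∀ k ξ, |Sup (V k) ξ| ≤ c ξ := fun k ξ => by
    have := hne k
    refine abs_le.mpr ⟨?_, ciSup_le fun d => (abs_le.mp (hbound k ξ d)).2⟩
    let d := Classical.arbitrary ↥(V k ∩ D)
    exact le_trans (abs_le.mp (hbound k ξ d)).1 (le_ciSup (hbdd k ξ) d)
  have hSint : ∀ k, Integrable (Sup (V k)) P := fun k =>
    hc.mono' (hSm _).aestronglyMeasurable (Eventually.of_forall fun ξ => habs k ξ)
  have hle : ∀ k ξ, ∀ x' ∈ V k, F ξ x' ≤ Sup (V k) ξ := fun k ξ x' hx' => by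
    refine le_of_not_gt fun hlt => ?_
    obtain ⟨d, hd, hdD⟩ := hDd.inter_open_nonempty (V k ∩ F ξ ⁻¹' Set.Ioi (Sup (V k) ξ))
      ((hBb.isOpen (hVB k)).inter ((hF ξ).isOpen_preimage _ isOpen_Ioi)) ⟨x', hx', hlt⟩
    exact absurd (le_ciSup (hbdd k ξ) ⟨d, hd.1, hdD⟩) (not_le.mpr hd.2)
  have hlim : Tendsto (fun k => ∫ ξ, Sup (V k) ξ ∂P) atTop (𝓝 (∫ ξ, F ξ x ∂P)) := by
    refine tendsto_integral_of_dominated_convergence c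
      (fun k => (hSint k).aestronglyMeasurable) hc
      (fun k => Eventually.of_forall fun ξ => habs k ξ) (Eventually.of_forall fun ξ => ?_)
    refine tendsto_order.mpr ⟨fun t ht => Eventually.of_forall fun k =>
      lt_of_lt_of_le ht (hle k ξ x (hxV k)), fun t ht => ?_⟩
    obtain ⟨t', ht', htt'⟩ := exists_between ht
    have hnb : F ξ ⁻¹' Set.Iio t' ∈ 𝓝 x := (hF ξ).continuousAt.preimage_mem_nhds (Iio_mem_nhds ht')
    obtain ⟨k₀, -, hk₀⟩ := hW.1.mem_iff.mp hnb
    filter_upwards [eventually_ge_atTop k₀] with k hk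
    have := hne k
    refine lt_of_le_of_lt (ciSup_le fun d => ?_) htt'
    exact (hk₀ (hW.2 hk (hVW k d.2.1).1) : F ξ d < t').le
  obtain ⟨k, hk⟩ := (hlim.eventually (gt_mem_nhds hr)).exists
  have h1 := (hω (V k) (hVB k) (hSint k)).eventually (gt_mem_nhds hk)
  filter_upwards [h1.prod_mk ((hBb.isOpen (hVB k)).mem_nhds (hxV k))] with p hp
  refine lt_of_le_of_lt ?_ hp.1
  exact mul_le_mul_of_nonneg_left (Finset.sum_le_sum fun j _ => hle k _ _ hp.2) (by positivity)

/-- A uniform law of large numbers: with probability one, the averages of a locally dominated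
continuous integrand over an iid sample converge continuously to the expectation. -/
theorem tendsto_sampleAverage [TopologicalSpace X] [SecondCountableTopology X]
    (hmeas : ∀ j, Measurable (ξs j)) (hlaw : ∀ j, Pr.map (ξs j) = P) (hindep : iIndepFun ξs Pr)
    {F : Ξ → X → ℝ} (hF : ∀ ξ, Continuous (F ξ)) (hFm : ∀ x, AEMeasurable (fun ξ => F ξ x) P)
    (hdom : ∀ x, ∃ c : Ξ → ℝ, Integrable c P ∧ ∀ᶠ x' in 𝓝 x, ∀ ξ, |F ξ x'| ≤ c ξ) :
    ∀ᵐ ω ∂Pr, ∀ x, Tendsto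
      (fun p : ℕ × X => 1 / (p.1 : ℝ) * ∑ j ∈ Finset.range p.1, F (ξs j ω) p.2)
      (atTop ×ˢ 𝓝 x) (𝓝 (∫ ξ, F ξ x ∂P)) := by
  filter_upwards [sampleAverage_lt_eventually hmeas hlaw hindep hF hFm hdom,
    sampleAverage_lt_eventually hmeas hlaw hindep (F := fun ξ x => -F ξ x) (fun ξ => (hF ξ).neg)
      (fun x => (hFm x).neg) (by simpa only [abs_neg] using hdom)] with ω h1 h2 x
  refine tendsto_order.mpr ⟨fun t ht => ?_, fun t ht => h1 x t ht⟩
  filter_upwards [h2 x (-t) (by rw [integral_neg]; linarith)] with p hp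
  rw [Finset.sum_neg_distrib, mul_neg] at hp
  linarith

end LargeNumbers

/-! ### Continuous convergence of the sample averages -/

section SampleAverages

variable {Ω Ξ U Z X : Type*} {m : ℕ}

theorem continuous_quantities [TopologicalSpace U] [TopologicalSpace Z] {g : Fin m → U → Z → ℝ}
    {s : Ξ → Z → U} (hs : ∀ ξ, Continuous (s ξ))
    (hg : ∀ i, Continuous fun p : U × Z => g i p.1 p.2) (ξ : Ξ) (i : Fin m) :
    Continuous fun z => quantities g s ξ z i :=
  (hg i).comp ((hs ξ).prodMk continuous_id)

theorem sampleAverage_sub (ξs : ℕ → Ξ) (ν : ℕ) (G H : Ξ → Z → Fin m → ℝ) (z : Z) (i : Fin m) :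
    sampleAverage ξs ν G z i - sampleAverage ξs ν H z i
      = 1 / (ν : ℝ) * ∑ j ∈ Finset.range ν, (G (ξs j) z i - H (ξs j) z i) := by
  simp only [sampleAverage, Finset.sum_sub_distrib, mul_sub]

theorem abs_sampleAverage_sub_le (ξs : ℕ → Ξ) (ν : ℕ) {G H : Ξ → Z → Fin m → ℝ} {z : Z} {i : Fin m}
    {b : Ξ → ℝ} (h : ∀ ξ, |G ξ z i - H ξ z i| ≤ b ξ) :
    |sampleAverage ξs ν G z i - sampleAverage ξs ν H z i|
      ≤ 1 / (ν : ℝ) * ∑ j ∈ Finset.range ν, b (ξs j) := by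
  rw [sampleAverage_sub, abs_mul, abs_of_nonneg (by positivity : 0 ≤ 1 / (ν : ℝ))]
  exact mul_le_mul_of_nonneg_left ((Finset.abs_sum_le_sum_abs _ _).trans
    (Finset.sum_le_sum fun j _ => h _)) (by positivity)

variable [MeasurableSpace Ω] {Pr : Measure Ω} [MeasurableSpace Ξ] {P : Measure Ξ}
  {ξs : ℕ → Ω → Ξ}

/-- The averages of the exact quantities of interest converge continuously to the expectations. -/
theorem tendsto_sampleAverage_quantities [TopologicalSpace U] [TopologicalSpace Z]
    [PseudoMetricSpace X] [SecondCountableTopology X]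
    (hmeas : ∀ j, Measurable (ξs j)) (hlaw : ∀ j, Pr.map (ξs j) = P) (hindep : iIndepFun ξs Pr)
    {g : Fin m → U → Z → ℝ} {s : Ξ → Z → U} {T : X → Z} {A : Set Z}
    (hcont : ContinuityAssumption P g s T)
    (hbdd : LocallyBoundedParam P (quantities g s) T A) :
    ∀ᵐ ω ∂Pr, ∀ x ∈ T ⁻¹' A, ∀ i, Tendsto
      (fun p : ℕ × X => sampleAverage (fun j => ξs j ω) p.1 (quantities g s) (T p.2) i)
      (atTop ×ˢ 𝓝[T ⁻¹' A] x) (𝓝 (expected P (quantities g s) (T x) i)) := by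
  obtain ⟨hs, hg, hm, hT⟩ := hcont
  have key : ∀ i, ∀ᵐ ω ∂Pr, ∀ x : ↥(T ⁻¹' A), Tendsto (fun p : ℕ × ↥(T ⁻¹' A) =>
      1 / (p.1 : ℝ) * ∑ j ∈ Finset.range p.1, quantities g s (ξs j ω) (T p.2) i)
      (atTop ×ˢ 𝓝 x) (𝓝 (∫ ξ, quantities g s ξ (T x) i ∂P)) := fun i => by
    refine tendsto_sampleAverage (X := ↥(T ⁻¹' A))
      (F := fun ξ x => quantities g s ξ (T x) i) hmeas hlaw hindep
      (fun ξ => (continuous_quantities hs hg ξ i).comp (hT.comp continuous_subtype_val))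
      (fun x => (measurable_pi_apply i).comp_aemeasurable (hm x)) fun x => ?_
    obtain ⟨ρ, c, hρ, -, hc, hle⟩ := hbdd x x.2
    refine ⟨c, hc, ?_⟩
    filter_upwards [Metric.closedBall_mem_nhds x hρ] with x' hx' ξ
    exact (norm_le_pi_norm (quantities g s ξ (T x')) i).trans (hle x' ⟨hx', x'.2⟩ ξ)
  filter_upwards [ae_all_iff.mpr key] with ω hω x hx i
  have h := hω i ⟨x, hx⟩
  rw [nhdsWithin_eq_map_subtype_coe hx, Filter.prod_map_right, tendsto_map'_iff]
  exact h

/-- The errors in the averages that come from the approximate solutions vanish, locally uniformly: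
the averages of `λ^η μ^κ` and `μ^κ` obey the strong law, and their coefficients vanish. -/
theorem tendsto_sampleAverage_sub_quantities [SeminormedAddCommGroup U] [PseudoMetricSpace X]
    (hmeas : ∀ j, Measurable (ξs j)) (hlaw : ∀ j, Pr.map (ξs j) = P) (hindep : iIndepFun ξs Pr)
    {g : Fin m → U → Z → ℝ} {s : Ξ → Z → U} {sν : ℕ → Ξ → Z → U} {T : X → Z} {A : Set Z}
    (hsol : SolutionAssumption P g s sν T A) :
    ∀ᵐ ω ∂Pr, ∀ x ∈ T ⁻¹' A, ∀ i, Tendsto (fun p : ℕ × X =>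
      sampleAverage (fun j => ξs j ω) p.1 (quantities g (sν p.1)) (T p.2) i
        - sampleAverage (fun j => ξs j ω) p.1 (quantities g s) (T p.2) i)
      (atTop ×ˢ 𝓝[T ⁻¹' A] x) (𝓝 0) := by
  obtain ⟨η, κ, lam, mu, ρ, π, Δ₀, Δ, hη, hκ, hnn, hpos, hint1, hint2, hgs, hloc⟩ := hsol
  filter_upwards [strong_law_sample hmeas hlaw hindep hint1,
    strong_law_sample hmeas hlaw hindep hint2] with ω h1 h2 x hx i
  obtain ⟨⟨Bπ, hBπ⟩, ⟨B₀, hB₀⟩, hΔ⟩ := hloc x hx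
  set M1 : ℕ → ℝ := fun ν =>
    1 / (ν : ℝ) * ∑ j ∈ Finset.range ν, lam (ξs j ω) ^ η * mu (ξs j ω) ^ κ
  set M2 : ℕ → ℝ := fun ν => 1 / (ν : ℝ) * ∑ j ∈ Finset.range ν, mu (ξs j ω) ^ κ
  have hρ : 0 < ρ x := (hpos x hx).1
  have hBall : ∀ᶠ x' in 𝓝[T ⁻¹' A] x, x' ∈ Metric.closedBall x (ρ x) ∩ T ⁻¹' A := by
    filter_upwards [self_mem_nhdsWithin,
      mem_nhdsWithin_of_mem_nhds (Metric.closedBall_mem_nhds x hρ)] with x' h h' using ⟨h', h⟩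
  have hΔ0 : Tendsto (fun p : ℕ × X => Δ p.1 p.2) (atTop ×ˢ 𝓝[T ⁻¹' A] x) (𝓝 0) := by
    refine Metric.tendsto_nhds.mpr fun ε hε => ?_
    filter_upwards [(Metric.tendstoUniformlyOn_iff.mp hΔ ε hε).prod_mk hBall] with p hp
    rw [dist_comm]
    exact hp.1 p.2 hp.2
  have hΔκ : Tendsto (fun p : ℕ × X => Δ p.1 p.2 ^ κ) (atTop ×ˢ 𝓝[T ⁻¹' A] x) (𝓝 0) := by
    simpa [Real.zero_rpow hκ.ne'] using hΔ0.rpow_const (Or.inr hκ.le)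
  have hlim : Tendsto (fun p : ℕ × X => Bπ * Δ p.1 p.2 ^ κ * (2 * B₀ ^ η * M1 p.1 + M2 p.1))
      (atTop ×ˢ 𝓝[T ⁻¹' A] x) (𝓝 0) := by
    have h5 := (hΔκ.const_mul Bπ).mul
      (((h1.comp tendsto_fst).const_mul (2 * B₀ ^ η)).add (h2.comp tendsto_fst))
    simpa using h5
  refine squeeze_zero_norm' ?_ hlim
  filter_upwards [(eventually_ge_atTop 1).prod_mk hBall] with p hp
  obtain ⟨hν, hball⟩ := hp
  obtain ⟨-, hπ0, hΔ00, hΔν⟩ := hpos p.2 hball.2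
  have hΔν0 := hΔν p.1 hν
  obtain ⟨hHol, hest⟩ := hgs p.2 hball.2
  have hπB : π p.2 ≤ Bπ := hBπ ⟨p.2, hball, rfl⟩
  have hΔB : Δ₀ p.2 ≤ B₀ := hB₀ ⟨p.2, hball, rfl⟩
  have hpt : ∀ ξ, |quantities g (sν p.1) ξ (T p.2) i - quantities g s ξ (T p.2) i|
      ≤ Bπ * Δ p.1 p.2 ^ κ * (2 * B₀ ^ η * (lam ξ ^ η * mu ξ ^ κ) + mu ξ ^ κ) := fun ξ => by
    obtain ⟨hl0, hm0⟩ := hnn ξ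
    obtain ⟨hmax, hdiff⟩ := hest ξ p.1 hν
    have hpow : ∀ u : U, ‖u‖ ≤ lam ξ * Δ₀ p.2 → ‖u‖ ^ η ≤ lam ξ ^ η * B₀ ^ η := fun u hu => by
      rw [← Real.mul_rpow hl0 (hΔ00.trans hΔB)]
      exact Real.rpow_le_rpow (norm_nonneg _)
        (hu.trans (mul_le_mul_of_nonneg_left hΔB hl0)) hη.le
    have hu := hpow _ ((le_max_right _ _).trans hmax)
    have hu' := hpow _ ((le_max_left _ _).trans hmax)
    have hd : ‖sν p.1 ξ (T p.2) - s ξ (T p.2)‖ ^ κ ≤ mu ξ ^ κ * Δ p.1 p.2 ^ κ := by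
      rw [← Real.mul_rpow hm0 hΔν0]
      exact Real.rpow_le_rpow (norm_nonneg _) hdiff hκ.le
    have hlB : 0 ≤ lam ξ ^ η * B₀ ^ η := le_trans (Real.rpow_nonneg (norm_nonneg _) _) hu
    calc |quantities g (sν p.1) ξ (T p.2) i - quantities g s ξ (T p.2) i|
        ≤ π p.2 * (‖sν p.1 ξ (T p.2)‖ ^ η + ‖s ξ (T p.2)‖ ^ η + 1)
            * ‖sν p.1 ξ (T p.2) - s ξ (T p.2)‖ ^ κ := hHol i _ _
      _ ≤ Bπ * (lam ξ ^ η * B₀ ^ η + lam ξ ^ η * B₀ ^ η + 1) * (mu ξ ^ κ * Δ p.1 p.2 ^ κ) := by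
          have := hπ0.le.trans hπB
          gcongr
      _ = _ := by ring
  refine (abs_sampleAverage_sub_le (fun j => ξs j ω) p.1 hpt).trans (le_of_eq ?_)
  rw [← Finset.mul_sum, Finset.sum_add_distrib, ← Finset.mul_sum]
  simp only [M1, M2]
  ring

end SampleAverages

section Smoothing

theorem max_le_smax {b : ℝ} (hb : 0 < b) (t : ℝ) : max 0 t ≤ smax t b := by
  have h1 : 0 < Real.exp (t / b) := Real.exp_pos _
  refine max_le (mul_nonneg hb.le (Real.log_nonneg (by linarith))) ?_
  have h2 : t / b ≤ Real.log (1 + Real.exp (t / b)) := by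
    rw [Real.le_log_iff_exp_le (by positivity)]; linarith
  calc t = b * (t / b) := by field_simp
    _ ≤ _ := mul_le_mul_of_nonneg_left h2 hb.le

theorem smax_le {b : ℝ} (hb : 0 < b) (t : ℝ) : smax t b ≤ max 0 t + b * Real.log 2 := by
  have h2 : Real.log (1 + Real.exp (t / b)) ≤ max 0 t / b + Real.log 2 := by
    rw [Real.log_le_iff_le_exp (by positivity), Real.exp_add, Real.exp_log two_pos]
    have h3 : 1 ≤ Real.exp (max 0 t / b) := Real.one_le_exp (by positivity)
    have h4 : Real.exp (t / b) ≤ Real.exp (max 0 t / b) :=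
      Real.exp_le_exp.mpr (div_le_div_of_nonneg_right (le_max_right _ _) hb.le)
    linarith
  calc smax t b ≤ b * (max 0 t / b + Real.log 2) := mul_le_mul_of_nonneg_left h2 hb.le
    _ = _ := by field_simp

variable {U Zh : Type*} {α b : ℝ}

theorem abs_smoothedPerf_sub_le (hα : α < 1) (hb : 0 < b) (g₁ g₂ : U → Zh → ℝ) (i : Fin 2) (u : U)
    (z : Zh × ℝ × ℝ) :
    |smoothedPerf α b g₁ g₂ i u z - bufferedPerf α g₁ g₂ i u z|
      ≤ 1 / (1 - α) * (b * Real.log 2) := by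
  have h1 : 0 < 1 - α := by linarith
  have h2 : 0 < Real.log 2 := Real.log_pos (by norm_num)
  fin_cases i
  · simp only [smoothedPerf, bufferedPerf, Fin.zero_eta, Matrix.cons_val_zero, sub_self, abs_zero]
    positivity
  · simp only [smoothedPerf, bufferedPerf, Fin.mk_one, Matrix.cons_val_one, Matrix.cons_val_fin_one]
    rw [add_sub_add_left_eq_sub, ← mul_sub, abs_mul, abs_of_nonneg (by positivity)]
    refine mul_le_mul_of_nonneg_left ?_ (by positivity)
    rw [abs_of_nonneg (sub_nonneg.mpr (max_le_smax hb _))]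
    linarith [smax_le hb (g₂ u z.1 - z.2.1)]

variable {Ω Ξ X : Type*} [MeasurableSpace Ω] {Pr : Measure Ω} [MeasurableSpace Ξ]
  {P : Measure Ξ} {ξs : ℕ → Ω → Ξ}

/-- With probability one, the averages of the smoothed quantities of interest at the approximate
solutions converge continuously to the expected quantities of interest. -/
theorem tendsto_sampleAverage_smoothed [NormedAddCommGroup U] [TopologicalSpace Zh]
    [PseudoMetricSpace X] [SecondCountableTopology X]
    (hmeas : ∀ j, Measurable (ξs j)) (hlaw : ∀ j, Pr.map (ξs j) = P) (hindep : iIndepFun ξs Pr)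
    (hα : α < 1) {g₁ g₂ : U → Zh → ℝ} {s : Ξ → Zh → U} {sν : ℕ → Ξ → Zh → U} {T : X → Zh}
    {Ah : Set Zh} {β : ℕ → ℝ}
    (hcont : ContinuityAssumption P (bufferedPerf α g₁ g₂) (extSol s) (extParam T))
    (hbdd : LocallyBoundedParam P (bufferedQuantities α g₁ g₂ s) (extParam T) (admissible Ah))
    (hsol : SolutionAssumption P (bufferedPerf α g₁ g₂) (extSol s) (fun ν => extSol (sν ν))
      (extParam T) (admissible Ah))
    (hβpos : ∀ ν, 1 ≤ ν → 0 < β ν) (hβ : Tendsto β atTop (𝓝 0)) :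
    ∀ᵐ ω ∂Pr, ∀ x ∈ extParam T ⁻¹' admissible Ah, ∀ i, Tendsto (fun p : ℕ × (X × ℝ × ℝ) =>
      sampleAverage (fun j => ξs j ω) p.1
        (quantities (smoothedPerf α (β p.1) g₁ g₂) (extSol (sν p.1))) (extParam T p.2) i)
      (atTop ×ˢ 𝓝[extParam T ⁻¹' admissible Ah] x)
      (𝓝 (expected P (bufferedQuantities α g₁ g₂ s) (extParam T x) i)) := by
  filter_upwards [tendsto_sampleAverage_quantities hmeas hlaw hindep hcont hbdd,
    tendsto_sampleAverage_sub_quantities hmeas hlaw hindep hsol] with ω h1 h2 x hx i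
  have h3 : Tendsto (fun p : ℕ × (X × ℝ × ℝ) =>
      sampleAverage (fun j => ξs j ω) p.1
        (quantities (smoothedPerf α (β p.1) g₁ g₂) (extSol (sν p.1))) (extParam T p.2) i
      - sampleAverage (fun j => ξs j ω) p.1
        (quantities (bufferedPerf α g₁ g₂) (extSol (sν p.1))) (extParam T p.2) i)
      (atTop ×ˢ 𝓝[extParam T ⁻¹' admissible Ah] x) (𝓝 0) := by
    have hlim : Tendsto (fun p : ℕ × (X × ℝ × ℝ) => 1 / (1 - α) * (β p.1 * Real.log 2))
        (atTop ×ˢ 𝓝[extParam T ⁻¹' admissible Ah] x) (𝓝 0) := by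
      simpa using ((hβ.comp tendsto_fst).mul_const (Real.log 2)).const_mul (1 / (1 - α))
    refine squeeze_zero_norm' ?_ hlim
    filter_upwards [(eventually_ge_atTop 1).prod_inl _] with p hν
    refine (abs_sampleAverage_sub_le (fun j => ξs j ω) p.1 fun ξ =>
      abs_smoothedPerf_sub_le hα (hβpos _ hν) g₁ g₂ i _ _).trans (le_of_eq ?_)
    have hν0 : (p.1 : ℝ) ≠ 0 := by
      have : 0 < p.1 := hν
      positivity
    rw [Finset.sum_const, Finset.card_range, nsmul_eq_mul, ← mul_assoc, one_div_mul_cancel hν0,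
      one_mul]
  have h4 := (h3.add (h2 x hx i)).add (h1 x hx i)
  rw [zero_add, zero_add] at h4
  refine h4.congr fun p => ?_
  ring

end Smoothing

/-! ### The objective functions -/

section Objectives

variable {Ξ U Zh : Type*} [MeasurableSpace Ξ] {P : Measure Ξ} {Ah : Set Zh} {f : Zh → ℝ}
  {g₁ g₂ : U → Zh → ℝ} {s : Ξ → Zh → U} {α : ℝ}

/-- The cost `f(z) + E[ĝ_1(s(ξ,z),z)]` of a control. -/
noncomputable def meanCost (P : Measure Ξ) (f : Zh → ℝ) (g₁ : U → Zh → ℝ) (s : Ξ → Zh → U)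
    (z : Zh) : ℝ :=
  f z + ∫ ξ, g₁ (s ξ z) z ∂P

theorem expected_bufferedQuantities_zero (z : Zh × ℝ × ℝ) :
    expected P (bufferedQuantities α g₁ g₂ s) z 0 = ∫ ξ, g₁ (s ξ z.1) z.1 ∂P := rfl

theorem expected_bufferedQuantities_one (z : Zh × ℝ × ℝ) :
    expected P (bufferedQuantities α g₁ g₂ s) z 1 = constraintMean P g₂ s α z := rfl

/-- The feasible set of the buffered problem consists of the controls with a finite objective
value, at which this value is the cost. -/
theorem bufferedObjective_lt_coe {z : Zh × ℝ × ℝ} {r : ℝ}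
    (h : bufferedObjective P Ah f g₁ g₂ s α z < r) :
    z ∈ admissible Ah ∧ constraintMean P g₂ s α z = 0 ∧ meanCost P f g₁ s z.1 < r := by
  unfold bufferedObjective objective monitor ind at h
  rw [expected_bufferedQuantities_zero, expected_bufferedQuantities_one] at h
  by_cases hz : z ∈ admissible Ah
  · by_cases hψ : constraintMean P g₂ s α z = 0
    · refine ⟨hz, hψ, ?_⟩
      simp only [hz, hψ, Set.mem_singleton_iff, if_true, zero_add, add_zero] at h
      exact_mod_cast h
    · simp [hz, hψ] at h
  · exfalso
    simp only [hz, if_false] at h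
    by_cases hψ : constraintMean P g₂ s α z = 0
    · simp [hψ] at h
    · simp [hψ] at h

end Objectives

section ApproximateObjectives

variable {Ξ U Zh X : Type*} {Ah : Set Zh} {f : Zh → ℝ} {g₁ g₂ : U → Zh → ℝ} {α : ℝ}
  {T : X → Zh} {ξs : ℕ → Ξ} {ν : ℕ} {sν : Ξ → Zh → U} {b y θ : ℝ}

theorem approxObjective_of_mem {x : X × ℝ × ℝ} (hx : x ∈ extParam T ⁻¹' admissible Ah) :
    approxObjective Ah f g₁ g₂ α T ξs ν sν b y θ x
      = ((f (T x.1)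
        + (sampleAverage ξs ν (quantities (smoothedPerf α b g₁ g₂) (extSol sν)) (extParam T x) 0
        + y * sampleAverage ξs ν (quantities (smoothedPerf α b g₁ g₂) (extSol sν)) (extParam T x) 1
        + θ * sampleAverage ξs ν (quantities (smoothedPerf α b g₁ g₂) (extSol sν))
            (extParam T x) 1 ^ 2) : ℝ) : EReal) := by
  unfold approxObjective objective augLagrangian ind
  rw [if_pos hx, zero_add, ← EReal.coe_add]
  rfl

theorem mem_of_approxObjective_lt_top {x : X × ℝ × ℝ}
    (h : approxObjective Ah f g₁ g₂ α T ξs ν sν b y θ x < ⊤) :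
    x ∈ extParam T ⁻¹' admissible Ah := by
  by_contra hx
  unfold approxObjective objective augLagrangian ind at h
  rw [if_neg hx, EReal.top_add_coe, EReal.top_add_coe] at h
  exact lt_irrefl _ h

theorem sampleAverage_smoothed_slack_zero (x : X) (γ σ σ' : ℝ) :
    sampleAverage ξs ν (quantities (smoothedPerf α b g₁ g₂) (extSol sν)) (extParam T (x, γ, σ)) 0
      = sampleAverage ξs ν (quantities (smoothedPerf α b g₁ g₂) (extSol sν))
        (extParam T (x, γ, σ')) 0 := rfl

theorem sampleAverage_smoothed_slack_one (hν : 1 ≤ ν) (x : X) (γ σ t : ℝ) :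
    sampleAverage ξs ν (quantities (smoothedPerf α b g₁ g₂) (extSol sν))
        (extParam T (x, γ, σ + t)) 1
      = sampleAverage ξs ν (quantities (smoothedPerf α b g₁ g₂) (extSol sν))
        (extParam T (x, γ, σ)) 1 + t := by
  have hν0 : (ν : ℝ) ≠ 0 := by
    have : 0 < ν := hν
    positivity
  have h : ∀ ξ, quantities (smoothedPerf α b g₁ g₂) (extSol sν) ξ (extParam T (x, γ, σ + t)) 1
      = quantities (smoothedPerf α b g₁ g₂) (extSol sν) ξ (extParam T (x, γ, σ)) 1 + t := by
    intro ξ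
    change σ + t + γ + 1 / (1 - α) * smax (g₂ (sν ξ (T x)) (T x) - γ) b
      = σ + γ + 1 / (1 - α) * smax (g₂ (sν ξ (T x)) (T x) - γ) b + t
    ring
  simp only [sampleAverage, h, Finset.sum_add_distrib, Finset.sum_const, Finset.card_range,
    nsmul_eq_mul]
  field_simp

/-- The value of a near-minimizer compared with the cost of an admissible `x'` whose averaged
constraint is negative: raising the slack of `x'` until the averaged constraint vanishes removes the
multiplier and penalty terms and leaves the cost unchanged. -/
theorem le_of_mem_nearArgmin_approxObjective (hν : 1 ≤ ν) {δ : ℝ≥0} {x x' : X × ℝ × ℝ}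
    (hx : x ∈ nearArgmin δ (approxObjective Ah f g₁ g₂ α T ξs ν sν b y θ))
    (hx' : extParam T x' ∈ admissible Ah)
    (hneg : sampleAverage ξs ν (quantities (smoothedPerf α b g₁ g₂) (extSol sν)) (extParam T x') 1
      < 0) :
    f (T x.1)
      + sampleAverage ξs ν (quantities (smoothedPerf α b g₁ g₂) (extSol sν)) (extParam T x) 0
      + (y * sampleAverage ξs ν (quantities (smoothedPerf α b g₁ g₂) (extSol sν)) (extParam T x) 1
      + θ * sampleAverage ξs ν (quantities (smoothedPerf α b g₁ g₂) (extSol sν))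
          (extParam T x) 1 ^ 2)
    ≤ f (T x'.1)
      + sampleAverage ξs ν (quantities (smoothedPerf α b g₁ g₂) (extSol sν)) (extParam T x') 0
      + δ := by
  obtain ⟨x₁, γ, σ⟩ := x'
  have hcomp : (x₁, γ, σ + -sampleAverage ξs ν (quantities (smoothedPerf α b g₁ g₂) (extSol sν))
      (extParam T (x₁, γ, σ)) 1) ∈ extParam T ⁻¹' admissible Ah :=
    ⟨hx'.1, add_nonneg hx'.2 (by linarith)⟩
  have h := hx.2.trans (add_le_add_left (iInf_le _ (x₁, γ, σ + -sampleAverage ξs ν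
    (quantities (smoothedPerf α b g₁ g₂) (extSol sν)) (extParam T (x₁, γ, σ)) 1)) _)
  rw [approxObjective_of_mem (mem_of_approxObjective_lt_top hx.1), approxObjective_of_mem hcomp,
    ← EReal.coe_add, EReal.coe_le_coe_iff, sampleAverage_smoothed_slack_one hν,
    sampleAverage_smoothed_slack_zero x₁ γ _ σ, add_neg_cancel] at h
  linarith

end ApproximateObjectives

/-! ### Cluster points of near-minimizers -/

section ClusterPoints

/-- A sequence of bounded augmented Lagrangian values with penalty parameters tending to infinity:
the constraint values vanish in the limit, and the limiting objective value obeys the bound. -/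
theorem penalty_limit {ι : Type*} {l : Filter ι} [l.NeBot] {a w y θ r : ι → ℝ} {a₀ w₀ r₀ M : ℝ}
    (ha : Tendsto a l (𝓝 a₀)) (hw : Tendsto w l (𝓝 w₀)) (hr : Tendsto r l (𝓝 r₀))
    (hθ : Tendsto θ l atTop) (hy : ∀ᶠ i in l, |y i| ≤ M)
    (h : ∀ᶠ i in l, a i + (y i * w i + θ i * w i ^ 2) ≤ r i) : w₀ = 0 ∧ a₀ ≤ r₀ := by
  have hyw : ∀ᶠ i in l, -(M * |w i|) ≤ y i * w i := by
    filter_upwards [hy] with i hi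
    have h1 := mul_le_mul_of_nonneg_right hi (abs_nonneg (w i))
    rw [← abs_mul] at h1
    linarith [neg_abs_le (y i * w i)]
  have hw0 : w₀ = 0 := by
    by_contra hne
    have h1 : Tendsto (fun i => θ i * w i ^ 2) l atTop :=
      hθ.atTop_mul_pos (by positivity : 0 < w₀ ^ 2) (hw.pow 2)
    have h2 : Tendsto (fun i => r i - a i + M * |w i|) l (𝓝 (r₀ - a₀ + M * |w₀|)) :=
      (hr.sub ha).add (hw.abs.const_mul M)
    refine not_tendsto_atTop_of_tendsto_nhds h2 (tendsto_atTop_mono' l ?_ h1)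
    filter_upwards [h, hyw] with i h3 h4
    linarith
  refine ⟨hw0, ?_⟩
  have h5 : Tendsto (fun i => a i - M * |w i|) l (𝓝 a₀) := by
    simpa [hw0] using ha.sub (hw.abs.const_mul M)
  refine le_of_tendsto_of_tendsto h5 hr ?_
  filter_upwards [h, hyw, hθ.eventually_ge_atTop 0] with i h3 h4 h6
  have := mul_nonneg h6 (sq_nonneg (w i))
  linarith

variable {Ξ U Zh X : Type*} [MeasurableSpace Ξ] {P : Measure Ξ} {Ah : Set Zh} {f : Zh → ℝ}
  {g₁ g₂ : U → Zh → ℝ} {s : Ξ → Zh → U} {α : ℝ} [TopologicalSpace Zh] [TopologicalSpace X]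
  {T : X → Zh} {ξs : ℕ → Ξ} {sν : ℕ → Ξ → Zh → U} {β y θ : ℕ → ℝ}

/-- If the averages converge continuously, then every cluster point of near-minimizers of the
approximating problems satisfies the constraint, and its cost is not larger, up to `δ`, than that of
a strictly feasible parameter `x'`. -/
theorem mapClusterPt_nearArgmin (hA : IsClosed (admissible Ah))
    (hf : ContinuousOn (fun z : Zh × ℝ × ℝ => f z.1) (admissible Ah))
    (hT : Continuous (extParam T))
    (hW : ∀ x ∈ extParam T ⁻¹' admissible Ah, ∀ i, Tendsto (fun p : ℕ × (X × ℝ × ℝ) =>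
      sampleAverage ξs p.1
        (quantities (smoothedPerf α (β p.1) g₁ g₂) (extSol (sν p.1))) (extParam T p.2) i)
      (atTop ×ˢ 𝓝[extParam T ⁻¹' admissible Ah] x)
      (𝓝 (expected P (bufferedQuantities α g₁ g₂ s) (extParam T x) i)))
    (hy : ∃ M, ∀ ν, 1 ≤ ν → |y ν| ≤ M) (hθ : Tendsto θ atTop atTop)
    {δs : ℕ → ℝ≥0} {δ : ℝ≥0} (hδ : Tendsto δs atTop (𝓝 δ)) {x : ℕ → X × ℝ × ℝ}
    (hx : ∀ ν, 1 ≤ ν → x ν ∈ nearArgmin (δs ν)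
      (approxObjective Ah f g₁ g₂ α T ξs ν (sν ν) (β ν) (y ν) (θ ν)))
    {xbar : X × ℝ × ℝ} (hxbar : MapClusterPt xbar atTop x)
    {x' : X × ℝ × ℝ} (hx' : extParam T x' ∈ admissible Ah)
    (hψ : constraintMean P g₂ s α (extParam T x') < 0) :
    extParam T xbar ∈ admissible Ah ∧ constraintMean P g₂ s α (extParam T xbar) = 0 ∧
      meanCost P f g₁ s (T xbar.1) ≤ meanCost P f g₁ s (T x'.1) + δ := by
  set C : Set (X × ℝ × ℝ) := extParam T ⁻¹' admissible Ah
  obtain ⟨W, hWdef⟩ : ∃ W : ℕ → X × ℝ × ℝ → Fin 2 → ℝ, ∀ ν x, W ν x = sampleAverage ξs ν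
    (quantities (smoothedPerf α (β ν) g₁ g₂) (extSol (sν ν))) (extParam T x) := ⟨_, fun _ _ => rfl⟩
  simp only [← hWdef] at hW
  obtain ⟨l, hl, hxl⟩ := mapClusterPt_iff_ultrafilter.mp hxbar
  obtain ⟨M, hM⟩ := hy
  have h1 : ∀ᶠ ν : ℕ in l, 1 ≤ ν := hl (eventually_ge_atTop 1)
  have hxC : ∀ᶠ ν in l, x ν ∈ C := by
    filter_upwards [h1] with ν hν using mem_of_approxObjective_lt_top (hx ν hν).1
  have hxbarC : xbar ∈ C := (hA.preimage hT).mem_of_tendsto hxl hxC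
  have hxlC : Tendsto x l (𝓝[C] xbar) := tendsto_nhdsWithin_iff.mpr ⟨hxl, hxC⟩
  have hpair : Tendsto (fun ν => (ν, x ν)) (l : Filter ℕ) (atTop ×ˢ 𝓝[C] xbar) :=
    Tendsto.prodMk (tendsto_id'.mpr hl) hxlC
  have hWx : ∀ i, Tendsto (fun ν => W ν (x ν) i) l
      (𝓝 (expected P (bufferedQuantities α g₁ g₂ s) (extParam T xbar) i)) := fun i =>
    (hW xbar hxbarC i).comp hpair
  have hpair' : Tendsto (fun ν => (ν, x')) (l : Filter ℕ) (atTop ×ˢ 𝓝[C] x') :=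
    Tendsto.prodMk (tendsto_id'.mpr hl) (tendsto_const_nhdsWithin hx')
  have hWx' : ∀ i, Tendsto (fun ν => W ν x' i) l
      (𝓝 (expected P (bufferedQuantities α g₁ g₂ s) (extParam T x') i)) := fun i =>
    (hW x' hx' i).comp hpair'
  have hneg : ∀ᶠ ν in l, W ν x' 1 < 0 := (hWx' 1).eventually (gt_mem_nhds hψ)
  have hfx : Tendsto (fun ν => f (T (x ν).1)) l (𝓝 (f (T xbar.1))) :=
    (hf.comp hT.continuousOn (fun _ h => h) xbar hxbarC).tendsto.comp hxlC
  have hδl : Tendsto (fun ν => (δs ν : ℝ)) l (𝓝 (δ : ℝ)) :=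
    (NNReal.tendsto_coe.mpr hδ).mono_left hl
  have hle : ∀ᶠ ν in l, f (T (x ν).1) + W ν (x ν) 0
      + (y ν * W ν (x ν) 1 + θ ν * W ν (x ν) 1 ^ 2) ≤ f (T x'.1) + W ν x' 0 + δs ν := by
    filter_upwards [h1, hneg] with ν hν hnegν
    rw [hWdef] at hnegν ⊢
    rw [hWdef]
    exact le_of_mem_nearArgmin_approxObjective hν (hx ν hν) hx' hnegν
  have hfin := penalty_limit (hfx.add (hWx 0)) (hWx 1) ((tendsto_const_nhds.add (hWx' 0)).add hδl)
    (hθ.mono_left hl) (h1.mono fun ν hν => hM ν hν) hle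
  exact ⟨hxbarC, hfin⟩

end ClusterPoints

/-! ### Integrability and continuity on the admissible set -/

section Admissible

variable {Ξ U Zh : Type*} [MeasurableSpace Ξ] {P : Measure Ξ} {Ah : Set Zh} {f : Zh → ℝ}
  {g₁ g₂ : U → Zh → ℝ} {s : Ξ → Zh → U} {α : ℝ}

theorem LocallyBounded.integrable {Z : Type*} {m : ℕ} [SeminormedAddCommGroup Z]
    {G : Ξ → Z → Fin m → ℝ} {A : Set Z} (h : LocallyBounded P G A) {z : Z} (hz : z ∈ A)
    (i : Fin m) : Integrable (fun ξ => G ξ z i) P := by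
  obtain ⟨hm, ρ, c, hρ, -, hc, hle⟩ := h z hz
  refine hc.mono' ((measurable_pi_apply i).comp_aemeasurable hm).aestronglyMeasurable
    (Eventually.of_forall fun ξ => ?_)
  exact (norm_le_pi_norm (G ξ z) i).trans (hle z hz (by simpa using hρ.le) ξ)

theorem LocallyBounded.continuousOn_expected {Z : Type*} {m : ℕ} [SeminormedAddCommGroup Z]
    {G : Ξ → Z → Fin m → ℝ} {A : Set Z} (h : LocallyBounded P G A) {i : Fin m}
    (hG : ∀ ξ, Continuous fun z => G ξ z i) : ContinuousOn (fun z => expected P G z i) A := by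
  intro z hz
  obtain ⟨-, ρ, c, hρ, -, hc, hle⟩ := h z hz
  refine tendsto_integral_filter_of_dominated_convergence c ?_ ?_ hc
    (Eventually.of_forall fun ξ => (hG ξ).continuousWithinAt)
  · filter_upwards [self_mem_nhdsWithin] with z' hz'
    exact (h.integrable hz' i).aestronglyMeasurable
  · filter_upwards [self_mem_nhdsWithin,
      mem_nhdsWithin_of_mem_nhds (Metric.closedBall_mem_nhds z hρ)] with z' hz' hb
    refine Eventually.of_forall fun ξ => (norm_le_pi_norm (G ξ z') i).trans (hle z' hz' ?_ ξ)
    simpa [dist_eq_norm] using hb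

theorem integrable_max_of_locallyBounded [SeminormedAddCommGroup Zh] (hα : α < 1)
    (hbdd : LocallyBounded P (bufferedQuantities α g₁ g₂ s) (admissible Ah)) {z : Zh} (hz : z ∈ Ah)
    [IsProbabilityMeasure P] (γ : ℝ) : Integrable (fun ξ => max 0 (g₂ (s ξ z) z - γ)) P := by
  have h1 : (z, γ, (0 : ℝ)) ∈ admissible Ah := ⟨hz, le_rfl⟩
  have h2 : Integrable (fun ξ => 0 + γ + 1 / (1 - α) * max 0 (g₂ (s ξ z) z - γ)) P :=
    hbdd.integrable h1 1
  have h3 : 1 - α ≠ 0 := by linarith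
  refine ((h2.sub (integrable_const γ)).const_mul (1 - α)).congr
    (Eventually.of_forall fun ξ => ?_)
  simp only [Pi.sub_apply]
  field_simp
  ring

theorem aemeasurable_of_locallyBounded [SeminormedAddCommGroup Zh] (hα : α < 1)
    (hbdd : LocallyBounded P (bufferedQuantities α g₁ g₂ s) (admissible Ah)) {z : Zh} (hz : z ∈ Ah)
    [IsProbabilityMeasure P] : AEMeasurable (fun ξ => g₂ (s ξ z) z) P := by
  -- Only the truncations `max {γ, ĝ_2}` are measurable by assumption.
  refine aemeasurable_of_tendsto_metrizable_ae atTop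
    (f := fun (k : ℕ) ξ => max 0 (g₂ (s ξ z) z - -(k : ℝ)) - k)
    (fun k => (integrable_max_of_locallyBounded hα hbdd hz _).aemeasurable.sub_const _)
    (Eventually.of_forall fun ξ => ?_)
  refine tendsto_const_nhds.congr' ?_
  filter_upwards [tendsto_natCast_atTop_atTop.eventually_ge_atTop (-g₂ (s ξ z) z)] with k hk
  rw [max_eq_right (by linarith)]
  ring

/-- The constraint of the buffered problem implies the bound on the buffered failure
probability. -/
theorem bPOE_le_of_constraintMean_eq_zero [SeminormedAddCommGroup Zh]
    (hα : α ∈ Set.Ioo (0 : ℝ) 1)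
    (hbdd : LocallyBounded P (bufferedQuantities α g₁ g₂ s) (admissible Ah))
    [IsProbabilityMeasure P]
    {z : Zh × ℝ × ℝ} (hz : z ∈ admissible Ah) (hψ : constraintMean P g₂ s α z = 0) :
    bPOE P (fun ξ => g₂ (s ξ z.1) z.1) ≤ 1 - α := by
  refine bPOE_le_of_ruFunction_nonpos (aemeasurable_of_locallyBounded hα.2 hbdd hz.1)
    (by simpa using integrable_max_of_locallyBounded hα.2 hbdd hz.1 0) hα (γ := z.2.1) ?_
  unfold constraintMean at hψ
  rw [integral_add (integrable_const _)
    ((integrable_max_of_locallyBounded hα.2 hbdd hz.1 z.2.1).const_mul _), integral_const_mul,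
    integral_const] at hψ
  simp only [probReal_univ, one_smul] at hψ
  have h0 : 0 ≤ z.2.2 := hz.2
  unfold ruFunction
  linarith

/-- For all large `n`, there are strictly feasible discretized controls whose cost exceeds the
optimal value by less than `ε`. -/
theorem exists_strictlyFeasible_of_controlQualification [NormedAddCommGroup Zh] {X : ℕ → Type*}
    {T : ∀ n, X n → Zh} {τ ε : ℝ}
    (hτ : ⨅ z, bufferedObjective P Ah f g₁ g₂ s α z = (τ : EReal))
    (hf : ContinuousOn (fun z : Zh × ℝ × ℝ => f z.1) (admissible Ah))
    (hbdd : LocallyBounded P (bufferedQuantities α g₁ g₂ s) (admissible Ah))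
    (hcont : ∀ ξ, Continuous fun z => bufferedQuantities α g₁ g₂ s ξ z 0)
    (hcq : ControlQualification P Ah g₂ s α T) (hε : 0 < ε) :
    ∀ᶠ n in atTop, ∃ x : X n × ℝ × ℝ, extParam (T n) x ∈ admissible Ah ∧
      constraintMean P g₂ s α (extParam (T n) x) < 0 ∧ meanCost P f g₁ s (T n x.1) < τ + ε := by
  have hlt : ⨅ z, bufferedObjective P Ah f g₁ g₂ s α z < ((τ + ε : ℝ) : EReal) := by
    rw [hτ, EReal.coe_lt_coe_iff]
    linarith
  obtain ⟨z, hz⟩ := iInf_lt_iff.mp hlt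
  obtain ⟨hzA, hψ, hcost⟩ := bufferedObjective_lt_coe hz
  obtain ⟨w, hw, hwA⟩ := hcq z hzA hψ
  have hcostc : ContinuousOn (fun z : Zh × ℝ × ℝ => meanCost P f g₁ s z.1) (admissible Ah) :=
    hf.add (hbdd.continuousOn_expected hcont)
  have hlim : Tendsto (fun n => meanCost P f g₁ s (w n).1) atTop (𝓝 (meanCost P f g₁ s z.1)) :=
    (hcostc z hzA).tendsto.comp
      (tendsto_nhdsWithin_iff.mpr ⟨hw, hwA.mono fun n h => h.1.1⟩)
  filter_upwards [hwA, hlim.eventually (gt_mem_nhds hcost)] with n h1 h2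
  obtain ⟨⟨hA, x, hx⟩, hneg⟩ := h1
  rw [← hx] at hA hneg h2
  exact ⟨x, hA, hneg, h2⟩

end Admissible

end OUU

/-! ### The optimality gap -/

theorem proposition4p9
    {Ω Ξ U Zh : Type*}
    -- the sample space and the space of realizations of the random field
    [MeasurableSpace Ω] (Pr : Measure Ω) [IsProbabilityMeasure Pr]
    [NormedAddCommGroup Ξ] [InnerProductSpace ℝ Ξ] [CompleteSpace Ξ]
    [MeasurableSpace Ξ] [BorelSpace Ξ] (P : Measure Ξ) [IsProbabilityMeasure P]
    -- the state space and the control space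
    [NormedAddCommGroup U] [NormedSpace ℝ U] [CompleteSpace U] [TopologicalSpace.SeparableSpace U]
    [NormedAddCommGroup Zh] [NormedSpace ℝ Zh] [CompleteSpace Zh]
    [TopologicalSpace.SeparableSpace Zh]
    -- the problem
    (Ah : Set Zh) (f : Zh → ℝ) (g₁ g₂ : U → Zh → ℝ) (s : Ξ → Zh → U)
    (α : ℝ) (hα : α ∈ Set.Ioo (0 : ℝ) 1)
    -- the approximations
    (T : ∀ n : ℕ, EuclideanSpace ℝ (Fin n) → Zh) (sν : ℕ → Ξ → Zh → U) (y θ β : ℕ → ℝ)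
    -- an iid sample from `P`
    (ξs : ℕ → Ω → Ξ) (hmeas : ∀ j, Measurable (ξs j)) (hlaw : ∀ j, Pr.map (ξs j) = P)
    (hindep : iIndepFun ξs Pr)
    -- assumptions on the problem
    (nbar : ℕ) (τ : ℝ)
    (hτ : ⨅ z, OUU.bufferedObjective P Ah f g₁ g₂ s α z = (τ : EReal))
    (hA : IsClosed (OUU.admissible Ah))
    (hf : ContinuousOn (fun z : Zh × ℝ × ℝ => f z.1) (OUU.admissible Ah))
    (hbdd : OUU.LocallyBounded P (OUU.bufferedQuantities α g₁ g₂ s) (OUU.admissible Ah))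
    (hcq : OUU.ControlQualification P Ah g₂ s α T)
    -- assumptions on the discretizations
    (hinf : ∀ n, nbar ≤ n →
      ⨅ x, OUU.bufferedObjective P Ah f g₁ g₂ s α (OUU.extParam (T n) x) < ⊤)
    (hcont : ∀ n, nbar ≤ n →
      OUU.ContinuityAssumption P (OUU.bufferedPerf α g₁ g₂) (OUU.extSol s) (OUU.extParam (T n)))
    (hbddn : ∀ n, nbar ≤ n →
      OUU.LocallyBoundedParam P (OUU.bufferedQuantities α g₁ g₂ s) (OUU.extParam (T n))
        (OUU.admissible Ah))
    (hsol : ∀ n, nbar ≤ n →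
      OUU.SolutionAssumption P (OUU.bufferedPerf α g₁ g₂) (OUU.extSol s)
        (fun ν => OUU.extSol (sν ν)) (OUU.extParam (T n)) (OUU.admissible Ah))
    (hcqn : ∀ n, nbar ≤ n → OUU.ParamQualification P Ah g₂ s α (T n))
    -- assumptions on multipliers, penalty parameters and smoothing parameters
    (hy : ∃ M, ∀ ν, 1 ≤ ν → |y ν| ≤ M)
    (hθpos : ∀ ν, 1 ≤ ν → 0 < θ ν) (hθ : Tendsto θ atTop atTop)
    (hβpos : ∀ ν, 1 ≤ ν → 0 < β ν) (hβ : Tendsto β atTop (𝓝 0)) :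
    ∀ᵐ ω ∂Pr, ∀ ε : ℝ, 0 < ε → ∃ nε, nbar ≤ nε ∧ ∀ n, nε ≤ n →
      ∀ (δs : ℕ → ℝ≥0) (δ : ℝ≥0), Tendsto δs atTop (𝓝 δ) →
      ∀ x : ℕ → EuclideanSpace ℝ (Fin n) × ℝ × ℝ,
      (∀ ν, 1 ≤ ν → x ν ∈ OUU.nearArgmin (δs ν)
        (OUU.approxObjective Ah f g₁ g₂ α (T n) (fun j => ξs j ω) ν (sν ν) (β ν) (y ν) (θ ν))) →
      ∀ xbar, MapClusterPt xbar atTop x →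
      OUU.extParam (T n) xbar ∈ OUU.admissible Ah ∧
      f (T n xbar.1) + ∫ ξ, g₁ (s ξ (T n xbar.1)) (T n xbar.1) ∂P ≤ τ + ε + δ ∧
      OUU.bPOE P (fun ξ => g₂ (s ξ (T n xbar.1)) (T n xbar.1)) ≤ 1 - α := by
  have hlim : ∀ᵐ ω ∂Pr, ∀ n, nbar ≤ n → ∀ x ∈ OUU.extParam (T n) ⁻¹' OUU.admissible Ah, ∀ i,
      Tendsto (fun p : ℕ × (EuclideanSpace ℝ (Fin n) × ℝ × ℝ) =>
        OUU.sampleAverage (fun j => ξs j ω) p.1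
          (OUU.quantities (OUU.smoothedPerf α (β p.1) g₁ g₂) (OUU.extSol (sν p.1)))
          (OUU.extParam (T n) p.2) i)
        (atTop ×ˢ 𝓝[OUU.extParam (T n) ⁻¹' OUU.admissible Ah] x)
        (𝓝 (OUU.expected P (OUU.bufferedQuantities α g₁ g₂ s) (OUU.extParam (T n) x) i)) := by
    rw [ae_all_iff]
    intro n
    by_cases hn : nbar ≤ n
    · filter_upwards [OUU.tendsto_sampleAverage_smoothed hmeas hlaw hindep hα.2 (hcont n hn)
        (hbddn n hn) (hsol n hn) hβpos hβ] with ω h _ using h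
    · exact Eventually.of_forall fun ω h => absurd h hn
  filter_upwards [hlim] with ω hω ε hε
  obtain ⟨hs, hg, -⟩ := hcont nbar le_rfl
  obtain ⟨N, hN⟩ := eventually_atTop.mp
    (OUU.exists_strictlyFeasible_of_controlQualification hτ hf hbdd
      (fun ξ => OUU.continuous_quantities hs hg ξ 0) hcq hε)
  refine ⟨max nbar N, le_max_left _ _, fun n hn δs δ hδ x hx xbar hxbar => ?_⟩
  have hn' : nbar ≤ n := (le_max_left _ _).trans hn
  obtain ⟨x', hx'A, hx'neg, hx'cost⟩ := hN n ((le_max_right _ _).trans hn)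
  obtain ⟨hA', hψ, hcost⟩ := OUU.mapClusterPt_nearArgmin hA hf (hcont n hn').2.2.2 (hω n hn') hy hθ
    hδ hx hxbar hx'A hx'neg
  refine ⟨hA', ?_, OUU.bPOE_le_of_constraintMean_eq_zero hα hbdd hA' hψ⟩
  have hle := hcost.trans (add_le_add_left hx'cost.le (δ : ℝ))
  simpa only [OUU.meanCost] using hle
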